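/- Let $n\ge 0$ be an integer and write $[m]=\{1,\dots,m\}$. **Unit interval positroids.** A finite poset $P$ is a unit interval order if there is an injective map $i\mapsto[q_i,q_i+1]$ from $P$ to the closed unit intervals of $\mathbb R$ such that $i<_P j$ if and only if $q_i+1<q_j$. A labeling of an $n$-element poset $P$ by $[n]$ is canonical if $\alpha(i)<\alpha(j)$ implies that the label of $i$ is smaller than the label of $j$, where $\alpha(i)=|\{k: k\le_P i\}|-|\{k: i\le_P k\}|$. Identifying elements with labels, the antiadjacency matrix of $P$ is the $n\times n$ matrix $A=(a_{i,j})$ with $a_{i,j}=0$ if $i<_P j$ and $a_{i,j}=1$ otherwise. Let $\psi(A)$ be the $n\times 2n$ matrix $(I_n\mid A')$ with $a'_{i,j}=(-1)^{n-i}a_{n+1-i,j}$. If a $d\times m$ real matrix has rank $d$ and nonnegative maximal minors, the matroid on $[m]$ whose bases are the sets indexing columns that form a basis of $\mathbb R^d$ is the positroid represented by that matrix. A unit interval positroid on $[2n]$ is a positroid represented by $\psi(A)$, where $A$ is the antiadjacency matrix of a canonically labeled unit interval order with $n$ elements. **Decorated permutations.** A decorated permutation of $[m]$ is a permutation of $[m]$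 each of whose fixed points is marked clockwise or counterclockwise. For a positroid $M$ on $[m]$ let $I_i$ be the lexicographically minimal basis of $M$ for the order $i<_i i+1<_i\dots<_i m<_i 1<_i\dots<_i i-1$. The decorated permutation $\pi_M$ is given, with indices modulo $m$, as follows: if $i\in I_i$ and $I_{i+1}=(I_i\setminus\{i\})\cup\{j\}$, then $\pi_M(j)=i$; if $I_{i+1}=I_i$, then $i$ is a fixed point, which is counterclockwise if $i\in I_i$ and clockwise if $i\notin I_i$. **Le-diagrams.** A Le-diagram $L$ of type $(d,m)$, $d\le m$, is a Young diagram (in English notation) contained in a $d\times(m-d)$ rectangle, with boxes filled with zeros and pluses so that no zero has both a plus above it in its column and a plus to its left in its row. Label the steps of the south-east border path of the diagram, from the north-east corner to the south-west corner of the rectangle, by $1,\dots,m$, and give opposite edges of the north-west border the same labels. A pipe enters at each label of the north-west border, moving south or east; it goes straight on in boxes with a zero and turns (south to east, east to south) in boxes with a plus. Put $\pi_L(i)=j$ if the pipe entering at $i$ leaves through the south-east border at $j$, and mark a fixed point counterclockwise if it labels vertical edges and clockwise if it labels horizontal edges. The Le-diagram $L$ parametrizes the positroid $M$ if $\pi_L=\pi_M$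 as decorated permutations. **Theorem.** A Le-diagram $L$ of type $(n,2n)$ parametrizes a unit interval positroid on $[2n]$ if and only if its shape is an $n\times n$ square and $L$ satisfies the following two conditions: 1. every column has exactly one plus, except the last (right-most) one, which has $n$ pluses; 2. the horizontal unit steps right below the bottom-most pluses of the columns are exactly the horizontal steps of a Dyck path of length $2n$ from the upper-left corner to the lower-right corner of the square, that is, of a path with $n$ unit steps south and $n$ unit steps east that stays weakly below the main diagonal. -/

import Mathlib

/-! Throughout, `[m] = {1, …, m}` is modelled by `Fin m` (the label `a` is the element of
value `a - 1`), and matrix rows and columns are numbered from `0`. -/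

/-! ### Unit interval orders and their matrices -/

/-- A poset is a unit interval order if its elements can be matched bijectively with a set of
closed unit intervals `[q i, q i + 1]` such that `i < j` iff `[q i, q i + 1]` lies strictly to
the left of `[q j, q j + 1]`. -/
def IsUnitIntervalOrder (P : Type) [PartialOrder P] : Prop :=
  ∃ q : P → ℝ, Function.Injective (fun i => Set.Icc (q i) (q i + 1)) ∧
    ∀ i j : P, i < j ↔ q i + 1 < q j

/-- The altitude `α(i) = |Λ_i| - |V_i|`: size of the order ideal minus size of the dual order
ideal of `i`. -/
noncomputable def altitude {P : Type} [PartialOrder P] (i : P) : ℤ :=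
  ((Set.Iic i).ncard : ℤ) - ((Set.Ici i).ncard : ℤ)

/-- An `n`-labeling is canonical if it respects altitude. -/
def IsCanonicalLabeling {P : Type} [PartialOrder P] {n : ℕ} (l : P ≃ Fin n) : Prop :=
  ∀ i j : P, altitude i < altitude j → l i < l j

open Classical in
/-- The antiadjacency matrix of a labeled poset: the entry `(i, j)` is `0` if the element
labeled `i` is smaller than the element labeled `j`, and `1` otherwise. -/
noncomputable def antiadjacencyMatrix {P : Type} [PartialOrder P] {n : ℕ} (l : P ≃ Fin n) :
    Matrix (Fin n) (Fin n) ℝ :=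
  Matrix.of fun i j => if l.symm i < l.symm j then 0 else 1

/-- The map `ψ` sending an `n × n` matrix `A` to the `n × 2n` matrix `(I_n | A')`, where `A'` is
`A` upside down with alternating signs: in 1-based indices the row `i` of `A'` is
`(-1)^(n-i)` times the row `n + 1 - i` of `A`. -/
def psiMatrix {n : ℕ} (A : Matrix (Fin n) (Fin n) ℝ) : Matrix (Fin n) (Fin (2 * n)) ℝ :=
  Matrix.of fun i c =>
    if h : c.val < n then (if c.val = i.val then 1 else 0)
    else (-1) ^ (n - 1 - i.val) * A i.rev ⟨c.val - n, by have := c.isLt; omega⟩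

/-! ### Positroids -/

/-- Full rank `d × m` real matrices all of whose maximal minors are nonnegative. -/
def matNonneg (d m : ℕ) : Set (Matrix (Fin d) (Fin m) ℝ) :=
  {A | A.rank = d ∧ ∀ f : Fin d ↪o Fin m, 0 ≤ (A.submatrix id f).det}

/-- `M` is the positroid `ρ(A)` represented by the matrix `A`, which has full rank and
nonnegative maximal minors: the ground set is all of `[m]`, and `B` is a basis of `M` iff the
columns of `A` indexed by `B` form a basis of `ℝ^d`. -/
def IsPositroidOf {d m : ℕ} (A : Matrix (Fin d) (Fin m) ℝ) (M : Matroid (Fin m)) : Prop :=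
  A ∈ matNonneg d m ∧ M.E = Set.univ ∧
    ∀ B : Set (Fin m), M.IsBase B ↔
      LinearIndepOn ℝ A.col B ∧ Submodule.span ℝ (A.col '' B) = ⊤

/-- `M` is a unit interval positroid on `[2n]`: the positroid represented by `ψ(A)`, where `A`
is the antiadjacency matrix of a canonically labeled unit interval order with `n` elements. -/
def IsUnitIntervalPositroid (n : ℕ) (M : Matroid (Fin (2 * n))) : Prop :=
  ∃ (P : Type) (_ : PartialOrder P) (l : P ≃ Fin n),
    IsUnitIntervalOrder P ∧ IsCanonicalLabeling l ∧
      IsPositroidOf (psiMatrix (antiadjacencyMatrix l)) M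

/-! ### Grassmann necklaces and decorated permutations -/

/-- The elements of `B` listed increasingly for the shifted order
`i <_i i+1 <_i … <_i m <_i 1 <_i … <_i i-1`, each element `x` being recorded by its position
`x - i` (modulo `m`) in that order. -/
def shiftedList {m : ℕ} (i : Fin m) (B : Finset (Fin m)) : List (Fin m) :=
  (B.image fun x => x - i).sort

/-- `I` is the Grassmann necklace of `M`: `I i` is the lexicographically minimal basis of `M`
with respect to the shifted linear `i`-order. -/
def IsNecklaceOf {m : ℕ} (M : Matroid (Fin m)) (I : Fin m → Finset (Fin m)) : Prop :=
  ∀ i, M.IsBase (I i : Set (Fin m)) ∧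
    ∀ B : Finset (Fin m), M.IsBase (B : Set (Fin m)) → shiftedList i (I i) ≤ shiftedList i B

/-- A decorated permutation of `[m]`: a permutation together with the set of those fixed points
that are marked counterclockwise (the other fixed points are marked clockwise). -/
structure DecoratedPerm (m : ℕ) where
  perm : Equiv.Perm (Fin m)
  ccw : Finset (Fin m)
  ccw_fixed : ∀ j ∈ ccw, perm j = j

/-- `π` is the decorated permutation of the Grassmann necklace `I`. Here `finRotate m` is
`i ↦ i + 1` modulo `m`. -/
def IsDecoratedPermOf {m : ℕ} (I : Fin m → Finset (Fin m)) (π : DecoratedPerm m) : Prop :=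
  ∀ i,
    (∀ j, i ∈ I i → I (finRotate m i) = insert j ((I i).erase i) → π.perm j = i) ∧
    (I (finRotate m i) = I i → i ∉ I i → π.perm i = i ∧ i ∉ π.ccw) ∧
    (I (finRotate m i) = I i → i ∈ I i → π.perm i = i ∧ i ∈ π.ccw)

/-! ### Le-diagrams -/

/-- A Le-diagram of type `(d, m)`: a Young diagram (English notation, the box `(i, j)` being in
row `i` and column `j`, counted from the top left corner) inside a `d × (m - d)` rectangle, with
boxes filled with pluses and zeros, such that no box with a zero has both a plus above it in its
column and a plus to its left in its row. -/
structure LeDiagram (d m : ℕ) where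
  rank_le : d ≤ m
  shape : YoungDiagram
  shape_subset : ∀ c ∈ shape.cells, c.1 < d ∧ c.2 < m - d
  pluses : Finset (ℕ × ℕ)
  pluses_subset : pluses ⊆ shape.cells
  le_condition : ∀ i j i' j' : ℕ, (i, j) ∈ shape.cells → i' < i → (i', j) ∈ pluses →
    j' < j → (i, j') ∈ pluses → (i, j) ∈ pluses

/-- The direction in which a pipe moves. -/
inductive PipeDirection
  | south
  | east

namespace LeDiagram

variable {d m : ℕ} (L : LeDiagram d m)

/-- The label (from `0` to `m - 1`) of the vertical step in row `i` of the south-east border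
path of the shape, which leads from the north-east corner to the south-west corner of the
`d × (m - d)` rectangle: the step is preceded by `i` vertical steps and by the horizontal steps
in the columns `j ≥ λ_i`. -/
def rowLabel (i : ℕ) : ℕ := i + (m - d - L.shape.rowLen i)

/-- The label (from `0` to `m - 1`) of the horizontal step in column `j` of the border path: it
is preceded by the horizontal steps in the columns to the right of `j` and by one vertical step
for each box in column `j`. -/
def colLabel (j : ℕ) : ℕ := (m - d - 1 - j) + L.shape.colLen j

/-- The label of the edge of the south-east border at which a pipe leaves the diagram, when it
is about to enter the box `(i, j)` from the north (moving south) or from the west (moving east).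
In a box with a zero (a cross) it goes straight on; in a box with a plus (an elbow joint) it
turns, from south to east or from east to south. -/
def pipeExit {d m : ℕ} (L : LeDiagram d m) (i j : ℕ) (h : PipeDirection) : ℕ :=
  if _hc : (i, j) ∈ L.shape.cells then
    if (i, j) ∈ L.pluses then
      match h with
      | .south => pipeExit L i (j + 1) .east
      | .east => pipeExit L (i + 1) j .south
    else
      match h with
      | .south => pipeExit L (i + 1) j .south
      | .east => pipeExit L i (j + 1) .east
  else
    match h with
    | .south => L.colLabel j
    | .east => L.rowLabel i
termination_by m - (i + j)
decreasing_by
  all_goals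
    have h1 := L.shape_subset _ _hc
    have h2 := L.rank_le
    simp only at h1
    omega

/-- `π` is the decorated permutation read off the pipe dream of `L`: the pipe that starts at the
label `a` on the north-west border ends at the label `π a` on the south-east border, opposite
edges having equal labels. A fixed point is counterclockwise iff it labels vertical edges. -/
def IsPipeDreamOf (π : DecoratedPerm m) : Prop :=
  (∀ (a : Fin m) (i : ℕ), i < d → a.val = L.rowLabel i →
    (π.perm a).val = L.pipeExit i 0 .east) ∧
  (∀ (a : Fin m) (j : ℕ), j < m - d → a.val = L.colLabel j →
    (π.perm a).val = L.pipeExit 0 j .south) ∧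
  (∀ a : Fin m, a ∈ π.ccw ↔ π.perm a = a ∧ ∃ i < d, a.val = L.rowLabel i)

/-- The Le-diagram `L` parametrizes the positroid `M`: the decorated permutation read off the
pipe dream of `L` is the decorated permutation of the Grassmann necklace of `M`. -/
def Parametrizes (M : Matroid (Fin m)) : Prop :=
  ∃ (I : Fin m → Finset (Fin m)) (π : DecoratedPerm m),
    IsNecklaceOf M I ∧ IsDecoratedPermOf I π ∧ L.IsPipeDreamOf π

/-- The horizontal unit steps right below the bottom-most pluses of the columns. The unit step
from the lattice point at depth `y` and abscissa `x` to the one at depth `y` and abscissa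
`x + 1` is recorded as `(y, x)`; it is the south side of the box `(y - 1, x)`. -/
def bottomSteps : Set (ℕ × ℕ) :=
  {s | ∃ i j : ℕ, (i, j) ∈ L.pluses ∧ (∀ i', (i', j) ∈ L.pluses → i' ≤ i) ∧ s = (i + 1, j)}

end LeDiagram

/-- The horizontal steps, recorded as above, of a Dyck path drawn from the north-west corner of
the square weakly below its main diagonal: `U` is a unit step to the south and `D` is a unit
step to the east. -/
def DyckWord.eastSteps (p : DyckWord) : Set (ℕ × ℕ) :=
  {s | ∃ k : ℕ, p.toList[k]? = some DyckStep.D ∧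
    s = ((p.toList.take k).count DyckStep.U, (p.toList.take k).count DyckStep.D)}

/-! Everything is encoded by a staircase `g`. By altitude, the elements below a given one in a
canonically labeled unit interval order form an initial segment of the labels, growing with the
label. So column `x ≥ n` of `ψ(A)` is an alternating vector supported on the rows up to `g x`, with
`g` antitone (`exists_staircaseMatrix_eq`). Every staircase arises in this way
(`IsStaircase.exists_unitIntervalOrder`), and its matrix has nonnegative maximal minors
(`det_staircaseMinor_nonneg`).

The decorated permutation of the positroid is the explicit derangement `StaircaseRel`. Each column
`x` lies in the span of the columns on the cyclic arc from `π x` up to, but excluding, `x`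
(`IsStaircase.col_mem_span`). A greedy argument then shows that the sets of those `x` met before `π
x` on the way round from `i` are the lexicographically minimal bases
(`isNecklaceOf_necklaceOfPerm`).

On the diagram side, placing a plus in row `g x` of column `x` and filling the last column gives a
Le-diagram whose pipes realize the same derangement (`HasStaircase.pipeExit_eq`). It is the only
one: the pipe of the last row forces the shape to be the square, and a square Le-diagram is
determined by its pipes (`IsSquare.pluses_eq`). Finally, the column counts together with the Dyck
path describe exactly the staircase fillings (`IsSquare.conditions_iff`). -/

/-- The data of a staircase: for each label `x` in `[n, 2n)` of a column, the row `g x` of its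
bottom-most plus. The condition `2 * n - 1 - x ≤ g x` says that the staircase stays weakly below
the main diagonal. -/
structure IsStaircase (n : ℕ) (g : ℕ → ℕ) : Prop where
  lt : ∀ x, n ≤ x → x < 2 * n → g x < n
  diag_le : ∀ x, n ≤ x → x < 2 * n → 2 * n - 1 - x ≤ g x
  anti : ∀ x y, n ≤ x → x ≤ y → y < 2 * n → g y ≤ g x

/-- The graph of the permutation of `[0, 2n)` attached to a staircase. -/
def StaircaseRel (n : ℕ) (g : ℕ → ℕ) (x y : ℕ) : Prop :=
  (x = n ∧ y = 0) ∨
  (x < n ∧ (∀ z, n ≤ z → z < 2 * n → g z ≠ x) ∧ y = x + 1) ∨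
  (x < n ∧ n ≤ y ∧ y < 2 * n ∧ g y = x ∧ (y + 1 < 2 * n → g (y + 1) ≠ x)) ∨
  (n < x ∧ x < 2 * n ∧ g x = g (x - 1) ∧ y = x - 1) ∨
  (n < x ∧ x < 2 * n ∧ g x ≠ g (x - 1) ∧ y = g x + 1)

/-! ### The permutation of a staircase. -/

namespace IsStaircase

variable {n : ℕ} {g : ℕ → ℕ}

/-- The bounds `lt` and `diag_le` meet at `x = n`. Hence column `n` of the matrix is the full
alternating vector, on which the span computations rest. -/
theorem apply_self (hg : IsStaircase n g) (hn : 0 < n) : g n = n - 1 := by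
  have h1 := hg.lt n le_rfl (by omega)
  have h2 := hg.diag_le n le_rfl (by omega)
  omega

theorem rel_lt (hg : IsStaircase n g) (hn : 0 < n) {x y : ℕ} (h : StaircaseRel n g x y) :
    y < 2 * n := by
  have h0 := hg.apply_self hn
  rcases h with h | h | h | h | h
  · omega
  · have := h.2.1 n le_rfl (by omega); omega
  · omega
  · omega
  · have := hg.lt x (by omega) (by omega); omega

/-- The labels that move forward are those of the identity block. This gives the cardinality `n` of
the necklace sets and later forces the diagram to be a square. -/
theorem rel_lt_iff (hg : IsStaircase n g) (hn : 0 < n) {x y : ℕ} (h : StaircaseRel n g x y) :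
    x < y ↔ x < n := by
  have h0 := hg.apply_self hn
  rcases h with h | h | h | h | h
  · omega
  · omega
  · omega
  · omega
  · have := hg.lt x (by omega) (by omega); omega

theorem rel_ne (hg : IsStaircase n g) (hn : 0 < n) {x y : ℕ} (h : StaircaseRel n g x y) :
    y ≠ x := by
  have h0 := hg.apply_self hn
  rcases h with h | h | h | h | h
  · omega
  · omega
  · omega
  · omega
  · have := hg.lt x (by omega) (by omega); omega

theorem exists_rel (n : ℕ) (g : ℕ → ℕ) {x : ℕ} (hx : x < 2 * n) : ∃ y, StaircaseRel n g x y := by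
  rcases lt_trichotomy x n with h | h | h
  · by_cases hz : ∀ z, n ≤ z → z < 2 * n → g z ≠ x
    · exact ⟨x + 1, Or.inr (Or.inl ⟨h, hz, rfl⟩)⟩
    · push Not at hz
      obtain ⟨z, hz1, hz2, hz3⟩ := hz
      -- The labels `y` with `g y = x` form a block; its largest element is the image of `x`.
      let S := (Finset.Ico n (2 * n)).filter fun y => g y = x
      have hS : S.Nonempty := ⟨z, by simp [S, hz1, hz2, hz3]⟩
      have hm := S.max'_mem hS
      have hm' := hm
      simp only [S, Finset.mem_filter, Finset.mem_Ico] at hm'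
      refine ⟨S.max' hS, Or.inr (Or.inr (Or.inl ⟨h, hm'.1.1, hm'.1.2, hm'.2, fun hlt he => ?_⟩))⟩
      have := S.le_max' (S.max' hS + 1) (by
        simp only [S, Finset.mem_filter, Finset.mem_Ico]; exact ⟨⟨by omega, hlt⟩, he⟩)
      omega
  · exact ⟨0, Or.inl ⟨h, rfl⟩⟩
  · by_cases hz : g x = g (x - 1)
    · exact ⟨x - 1, Or.inr (Or.inr (Or.inr (Or.inl ⟨h, hx, hz, rfl⟩)))⟩
    · exact ⟨g x + 1, Or.inr (Or.inr (Or.inr (Or.inr ⟨h, hx, hz, rfl⟩)))⟩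

/-- Two labels in the same block of a staircase, both first in the block, agree. -/
theorem eq_of_first (hg : IsStaircase n g) {y z : ℕ} (hy : n < y) (hy' : y < 2 * n) (hz : n < z)
    (hz' : z < 2 * n) (h : g y = g z) (hl : g y ≠ g (y - 1)) (hl' : g z ≠ g (z - 1)) :
    y = z := by
  rcases lt_trichotomy y z with hlt | rfl | hlt
  · have h1 := hg.anti (z - 1) z (by omega) (by omega) (by omega)
    have h2 := hg.anti y (z - 1) (by omega) (by omega) (by omega)
    omega
  · rfl
  · have h1 := hg.anti (y - 1) y (by omega) (by omega) (by omega)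
    have h2 := hg.anti z (y - 1) (by omega) (by omega) (by omega)
    omega

theorem rel_injective (hg : IsStaircase n g) (hn : 0 < n) {x y z : ℕ}
    (h : StaircaseRel n g x z) (h' : StaircaseRel n g y z) : x = y := by
  have h0 := hg.apply_self hn
  have hlt : ∀ w, n < w → w < 2 * n → g w ≤ g (w - 1) ∧ g (w - 1) < n := fun w h1 h2 =>
    ⟨hg.anti (w - 1) w (by omega) (by omega) h2, hg.lt _ (by omega) (by omega)⟩
  have hx := hlt x
  have hy := hlt y
  have hz : z = n → g z = n - 1 := fun h => h ▸ h0
  -- What survives `omega` are the collisions between cases two and three, two and five, three and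
  -- four, in either order, and of case five with itself. They need the conditions on `g` at further
  -- labels.
  rcases h with h | h | h | h | h <;> rcases h' with h' | h' | h' | h' | h' <;> try omega
  · have := h.2.1 n le_rfl (by omega)
    omega
  · exact absurd (by omega) (h.2.1 y (by omega) (by omega))
  · obtain ⟨_, h1, h2, h3, h4⟩ := h
    have e : z = y - 1 := h'.2.2.2
    subst e
    have h5 := h4 (by omega)
    rw [show y - 1 + 1 = y by omega] at h5
    omega
  · have := h'.2.1 n le_rfl (by omega)
    omega
  · obtain ⟨_, h1, h2, h3, h4⟩ := h'
    have e : z = x - 1 := h.2.2.2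
    subst e
    have h5 := h4 (by omega)
    rw [show x - 1 + 1 = x by omega] at h5
    omega
  · exact absurd (by omega) (h'.2.1 x (by omega) (by omega))
  · exact hg.eq_of_first h.1 h.2.1 h'.1 h'.2.1 (by omega) h.2.2.1 h'.2.2.1

/-- The permutation attached to a staircase. -/
theorem exists_perm (hg : IsStaircase n g) (hn : 0 < n) :
    ∃ π : Equiv.Perm (Fin (2 * n)), ∀ x : Fin (2 * n), StaircaseRel n g x.val (π x).val := by
  choose f hf using fun x : Fin (2 * n) => exists_rel n g x.isLt
  let F : Fin (2 * n) → Fin (2 * n) := fun x => ⟨f x, hg.rel_lt hn (hf x)⟩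
  have hF : Function.Injective F := fun x y hxy => by
    have h1 : f x = f y := congrArg Fin.val hxy
    have h2 := hf y
    rw [← h1] at h2
    exact Fin.ext (hg.rel_injective hn (hf x) h2)
  exact ⟨Equiv.ofBijective F (Finite.injective_iff_bijective.mp hF), hf⟩

end IsStaircase

/-! ### Grassmann necklaces of derangements. -/

section Necklace

variable {m : ℕ}

theorem Fin.val_sub_eq_ite (x i : Fin m) :
    (x - i).val = if i.val ≤ x.val then x.val - i.val else m + x.val - i.val := by
  split_ifs with h
  · exact Fin.coe_sub_iff_le.mpr h
  · exact Fin.coe_sub_iff_lt.mpr (not_le.mp h)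

theorem val_finRotate (i : Fin m) :
    (finRotate m i).val = if i.val + 1 = m then 0 else i.val + 1 := by
  obtain _ | k := m
  · exact i.elim0
  · rw [coe_finRotate]
    simp [Fin.ext_iff]

/-- The Grassmann necklace of a derangement: `x` belongs to the `i`-th set iff, going around the
circle from `i`, one meets `x` before `π x`. -/
def necklaceOfPerm (π : Equiv.Perm (Fin m)) (i : Fin m) : Finset (Fin m) :=
  Finset.univ.filter fun x => (x - i).val < (π x - i).val

variable {π : Equiv.Perm (Fin m)}

theorem mem_necklaceOfPerm {i x : Fin m} :
    x ∈ necklaceOfPerm π i ↔ (x - i).val < (π x - i).val := by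
  simp [necklaceOfPerm]

theorem mem_necklaceOfPerm_self (hπ : ∀ x, π x ≠ x) (i : Fin m) : i ∈ necklaceOfPerm π i := by
  have h := hπ i
  rw [Ne, Fin.ext_iff] at h
  have := (π i).isLt
  rw [mem_necklaceOfPerm, Fin.val_sub_eq_ite, Fin.val_sub_eq_ite]
  split_ifs <;> omega

theorem symm_notMem_necklaceOfPerm (i : Fin m) : π.symm i ∉ necklaceOfPerm π i := by
  rw [mem_necklaceOfPerm, Equiv.apply_symm_apply, Fin.val_sub_eq_ite, Fin.val_sub_eq_ite]
  split_ifs <;> omega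

/-- Moving the base point from `i` to `i + 1` sends `i` from the first position to the last and
keeps the order of the rest. So only `i` and the element whose image is `i` change status. -/
theorem necklaceOfPerm_finRotate (hπ : ∀ x, π x ≠ x) (i : Fin m) :
    necklaceOfPerm π (finRotate m i) = insert (π.symm i) ((necklaceOfPerm π i).erase i) := by
  ext x
  have h := hπ x
  rw [Ne, Fin.ext_iff] at h
  have h1 : x = π.symm i ↔ (π x).val = i.val := by rw [Equiv.eq_symm_apply, Fin.ext_iff]
  rw [Finset.mem_insert, Finset.mem_erase, h1, Ne, Fin.ext_iff, mem_necklaceOfPerm,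
    mem_necklaceOfPerm, Fin.val_sub_eq_ite, Fin.val_sub_eq_ite, Fin.val_sub_eq_ite,
    Fin.val_sub_eq_ite, val_finRotate]
  have := (π x).isLt
  have := x.isLt
  have := i.isLt
  split_ifs <;> omega

theorem card_necklaceOfPerm_finRotate (hπ : ∀ x, π x ≠ x) (i : Fin m) :
    (necklaceOfPerm π (finRotate m i)).card = (necklaceOfPerm π i).card := by
  rw [necklaceOfPerm_finRotate hπ, Finset.card_insert_of_notMem
    (fun h => symm_notMem_necklaceOfPerm i (Finset.mem_of_mem_erase h)),
    Finset.card_erase_add_one (mem_necklaceOfPerm_self hπ i)]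

theorem card_necklaceOfPerm (hπ : ∀ x, π x ≠ x) (i : Fin m) :
    (necklaceOfPerm π i).card = (Finset.univ.filter fun x => x < π x).card := by
  obtain ⟨k, hk⟩ := i
  induction k with
  | zero =>
    congr 1
    ext x
    rw [mem_necklaceOfPerm, Fin.val_sub_eq_ite, Fin.val_sub_eq_ite]
    simp
  | succ k ih =>
    rw [← ih (by omega), ← card_necklaceOfPerm_finRotate hπ ⟨k, by omega⟩]
    refine congrArg (fun i => (necklaceOfPerm π i).card) (Fin.ext ?_)
    rw [val_finRotate, if_neg (by simp only; omega)]

/-- The decorated permutation of the necklace of a derangement. -/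
theorem isDecoratedPermOf_necklaceOfPerm (hπ : ∀ x, π x ≠ x) (σ : DecoratedPerm m) :
    IsDecoratedPermOf (necklaceOfPerm π) σ ↔ σ.perm = π := by
  have hmem := fun i => mem_necklaceOfPerm_self hπ i
  have hrot := fun i => necklaceOfPerm_finRotate hπ i
  constructor
  · intro h
    have : ∀ i, σ.perm (π.symm i) = i := fun i => (h i).1 _ (hmem i) (hrot i)
    ext x
    have := this (π x)
    rw [Equiv.symm_apply_apply] at this
    rw [this]
  · rintro rfl i
    have hne : necklaceOfPerm σ.perm (finRotate m i) ≠ necklaceOfPerm σ.perm i := fun h => by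
      have h1 := hmem i
      rw [← h, hrot, Finset.mem_insert] at h1
      rcases h1 with h1 | h1
      · exact hπ i (by rw [Equiv.eq_symm_apply] at h1; exact h1)
      · simp at h1
    refine ⟨fun j _ hj => ?_, fun h => absurd h hne, fun h => absurd h hne⟩
    rw [hrot] at hj
    have h1 : σ.perm.symm i ∈ insert j ((necklaceOfPerm σ.perm i).erase i) :=
      hj ▸ Finset.mem_insert_self _ _
    rcases Finset.mem_insert.mp h1 with h1 | h1
    · rw [← h1, Equiv.apply_symm_apply]
    · exact absurd (Finset.mem_of_mem_erase h1) (symm_notMem_necklaceOfPerm i)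

end Necklace

/-! ### Lexicographic comparison of bases. -/

section ShiftedLists

variable {m : ℕ}

theorem mem_shiftedList {i x : Fin m} {B : Finset (Fin m)} :
    x - i ∈ shiftedList i B ↔ x ∈ B := by
  obtain _ | k := m
  · exact i.elim0
  · simp [shiftedList]

theorem exists_of_mem_shiftedList {i y : Fin m} {B : Finset (Fin m)} (h : y ∈ shiftedList i B) :
    ∃ x ∈ B, x - i = y := by
  simpa [shiftedList] using h

theorem sortedLT_shiftedList (i : Fin m) (B : Finset (Fin m)) :
    (shiftedList i B).SortedLT :=
  Finset.sortedLT_sort _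

theorem shiftedList_injective (i : Fin m) : Function.Injective (shiftedList i) := by
  intro B C h
  ext x
  rw [← mem_shiftedList (i := i), h, mem_shiftedList]

/-- Shifted lists are totally ordered and determine their sets, so exhibiting one necklace of `M`
suffices. -/
theorem isNecklaceOf_unique {M : Matroid (Fin m)} {I J : Fin m → Finset (Fin m)}
    (hI : IsNecklaceOf M I) (hJ : IsNecklaceOf M J) : I = J :=
  funext fun i => shiftedList_injective i
    (le_antisymm ((hI i).2 _ (hJ i).1) ((hJ i).2 _ (hI i).1))

/-- If the shifted list of `B` is smaller than that of `I`, and `I` is not a proper superset of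
`B`, then at the first difference the entry `b` of `B` is not in `I`, and the elements of `I`
before `b` are in `B`. -/
theorem exists_of_shiftedList_lt {i : Fin m} {B I : Finset (Fin m)}
    (h : shiftedList i B < shiftedList i I) (hBI : ¬ B ⊂ I) :
    ∃ b ∈ B, b ∉ I ∧ ∀ y ∈ I, (y - i).val < (b - i).val → y ∈ B := by
  rcases List.lt_iff_exists.mp h with ⟨h1, h2⟩ | ⟨k, hk, hk', h1, h2⟩
  · refine absurd (Finset.ssubset_iff_subset_ne.mpr ⟨fun x hx => ?_, ?_⟩) hBI
    · rw [← mem_shiftedList (i := i)] at hx ⊢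
      rw [h1] at hx
      exact List.mem_of_mem_take hx
    · rintro rfl
      exact lt_irrefl _ h2
  · obtain ⟨b, hb, hbk⟩ := exists_of_mem_shiftedList (List.getElem_mem hk)
    refine ⟨b, hb, fun hbI => ?_, fun y hy hyb => ?_⟩
    · rw [← mem_shiftedList (i := i)] at hbI
      obtain ⟨l, hl, hlb⟩ := List.getElem_of_mem hbI
      rw [← hbk, ← hlb] at h2
      have hlk : l < k := (sortedLT_shiftedList i I).strictMono_get.lt_iff_lt
        (a := ⟨l, hl⟩) (b := ⟨k, hk'⟩) |>.mp h2
      have := (sortedLT_shiftedList i B).strictMono_get (a := ⟨l, by omega⟩) (b := ⟨k, hk⟩) hlk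
      simp only [List.get_eq_getElem] at this
      rw [h1 l hlk, hlb, ← hbk] at this
      exact lt_irrefl _ this
    · rw [← mem_shiftedList (i := i)] at hy ⊢
      obtain ⟨l, hl, hly⟩ := List.getElem_of_mem hy
      have h3 : (shiftedList i I)[l] < (shiftedList i I)[k] := by
        rw [hly]; exact lt_trans (by rw [← hbk]; exact hyb) h2
      have hlk : l < k := (sortedLT_shiftedList i I).strictMono_get.lt_iff_lt
        (a := ⟨l, hl⟩) (b := ⟨k, hk'⟩) |>.mp h3
      rw [← hly, ← h1 l hlk]
      exact List.getElem_mem _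

end ShiftedLists

/-! ### Column matroids and their minimal bases. -/

section Represented

variable {d m : ℕ} {A : Matrix (Fin d) (Fin m) ℝ}

/-- The matroid of the columns of a matrix whose columns span. -/
theorem exists_matroid_of_span_eq_top (hA : Submodule.span ℝ (Set.range A.col) = ⊤) :
    ∃ M : Matroid (Fin m), M.E = Set.univ ∧ ∀ B : Set (Fin m), M.IsBase B ↔
      LinearIndepOn ℝ A.col B ∧ Submodule.span ℝ (A.col '' B) = ⊤ := by
  refine ⟨Matroid.ofExistsFiniteIsBase Set.univ
    (fun B => LinearIndepOn ℝ A.col B ∧ Submodule.span ℝ (A.col '' B) = ⊤) ?_ ?_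
    (fun _ _ => Set.subset_univ _), rfl, fun B => Iff.rfl⟩
  · obtain ⟨B, -, -, h1, h2⟩ := exists_linearIndepOn_extension (K := ℝ) (v := A.col)
      (linearIndepOn_empty ℝ A.col) (Set.empty_subset Set.univ)
    refine ⟨B, ⟨h2, top_le_iff.mp ?_⟩, Set.toFinite B⟩
    rw [← hA, ← Set.image_univ]
    exact Submodule.span_le.mpr h1
  · rintro X Y ⟨hX, hX'⟩ ⟨-, hY'⟩ a ⟨haX, haY⟩
    have ha : A.col a ∉ Submodule.span ℝ (A.col '' (X \ {a})) := 
      linearIndepOn_iff_notMem_span.mp hX a haX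
    obtain ⟨b, hbY, hb⟩ : ∃ b ∈ Y, A.col b ∉ Submodule.span ℝ (A.col '' (X \ {a})) := by
      by_contra! hcon
      have : Submodule.span ℝ (A.col '' Y) ≤ Submodule.span ℝ (A.col '' (X \ {a})) :=
        Submodule.span_le.mpr (by rintro _ ⟨y, hy, rfl⟩; exact hcon y hy)
      rw [hY', top_le_iff] at this
      exact ha (this ▸ Submodule.mem_top)
    have hbX : b ∉ X := fun hbX => by
      by_cases hba : b = a
      · exact haY (hba ▸ hbY)
      · exact hb (Submodule.subset_span ⟨b, ⟨hbX, hba⟩, rfl⟩)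
    refine ⟨b, ⟨hbY, hbX⟩, (hX.mono Set.sdiff_subset).insert hb, top_le_iff.mp ?_⟩
    have hXa : A.col '' X = insert (A.col a) (A.col '' (X \ {a})) := by
      rw [← Set.image_insert_eq, Set.insert_sdiff_singleton, Set.insert_eq_of_mem haX]
    have h1 : A.col a ∈ Submodule.span ℝ (insert (A.col b) (A.col '' (X \ {a}))) :=
      mem_span_insert_exchange (by rw [← hXa, hX']; exact Submodule.mem_top) hb
    rw [← hX', hXa, Set.image_insert_eq]
    refine Submodule.span_le.mpr (Set.insert_subset h1 ?_)
    exact (Set.subset_insert _ _).trans Submodule.subset_span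

/-- A set of columns of the right cardinality that generates every other column from columns
that precede it cyclically is the lexicographically minimal basis. -/
theorem isNecklaceOf_necklaceOfPerm {M : Matroid (Fin m)} {π : Equiv.Perm (Fin m)}
    (hM : ∀ B : Set (Fin m), M.IsBase B ↔
      LinearIndepOn ℝ A.col B ∧ Submodule.span ℝ (A.col '' B) = ⊤)
    (hA : Submodule.span ℝ (Set.range A.col) = ⊤) (hπ : ∀ x, π x ≠ x)
    (hcard : (Finset.univ.filter fun x => x < π x).card = d)
    (hspan : ∀ x, A.col x ∈
      Submodule.span ℝ (A.col '' {y | (y - π x).val < (x - π x).val})) :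
    IsNecklaceOf M (necklaceOfPerm π) := by
  intro i
  -- If `x` is not in the set, `π x` comes before `x` in the order from `i`, so the arc in `hspan`
  -- consists of elements between `i` and `x`. Those outside the set are replaced by induction on
  -- the position.
  have key : ∀ k : ℕ, ∀ x : Fin m, (x - i).val = k → x ∉ necklaceOfPerm π i →
      A.col x ∈ Submodule.span ℝ
        (A.col '' {y | y ∈ necklaceOfPerm π i ∧ (y - i).val < (x - i).val}) := by
    intro k
    induction k using Nat.strong_induction_on with
    | _ k ih =>
      intro x hk hx
      have hx' := hx
      rw [mem_necklaceOfPerm] at hx'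
      have hxπ := hπ x
      rw [Ne, Fin.ext_iff] at hxπ
      refine Submodule.span_le.mpr ?_ (hspan x)
      rintro _ ⟨y, hy, rfl⟩
      have hyx : (y - i).val < (x - i).val := by
        simp only [Set.mem_ofPred_eq] at hy
        rw [Fin.val_sub_eq_ite, Fin.val_sub_eq_ite] at hy hx' ⊢
        have := (π x).isLt
        have := x.isLt
        have := i.isLt
        have := y.isLt
        split_ifs at hy hx' ⊢ <;> omega
      by_cases hyI : y ∈ necklaceOfPerm π i
      · exact Submodule.subset_span ⟨y, ⟨hyI, hyx⟩, rfl⟩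
      · refine Submodule.span_mono (Set.image_mono ?_) (ih _ (hk ▸ hyx) y rfl hyI)
        exact fun z hz => ⟨hz.1, hz.2.trans hyx⟩
  have hspan' : Submodule.span ℝ (A.col '' (necklaceOfPerm π i : Set (Fin m))) = ⊤ := by
    rw [← top_le_iff, ← hA]
    refine Submodule.span_le.mpr ?_
    rintro _ ⟨x, rfl⟩
    by_cases hx : x ∈ necklaceOfPerm π i
    · exact Submodule.subset_span ⟨x, hx, rfl⟩
    · exact Submodule.span_mono (Set.image_mono fun z hz => hz.1) (key _ x rfl hx)
  have hbase : M.IsBase (necklaceOfPerm π i : Set (Fin m)) := by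
    refine (hM _).mpr ⟨?_, hspan'⟩
    refine linearIndependent_of_top_le_span_of_card_eq_finrank ?_ ?_
    · rw [← hspan', Set.image_eq_range]
    · simp [card_necklaceOfPerm hπ, hcard]
  refine ⟨hbase, fun B hB => not_lt.mp fun hlt => ?_⟩
  -- At the first difference, `b` is generated by earlier elements of the necklace set, all of which
  -- lie in `B`. This contradicts the independence of `B`.
  obtain ⟨b, hbB, hbI, hb⟩ := exists_of_shiftedList_lt hlt fun hss =>
    hss.2 (Finset.coe_subset.mp (hB.eq_of_subset_isBase hbase
      (Finset.coe_subset.mpr hss.1)).ge)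
  refine linearIndepOn_iff_notMem_span.mp ((hM _).mp hB).1 b hbB ?_
  refine Submodule.span_mono (Set.image_mono ?_) (key _ b rfl hbI)
  rintro y ⟨hy, hyb⟩
  exact ⟨hb y hy hyb, fun h => hbI (Set.mem_singleton_iff.mp h ▸ hy)⟩

end Represented

/-! ### Linear relations between the columns of a staircase matrix. -/

section StaircaseColumns

variable {n : ℕ}

/-- The vector whose first `k` coordinates are alternating signs, ending with the sign `+` in the
last coordinate `n - 1` if `k = n`, and whose other coordinates vanish. -/
def alternatingVec (n k : ℕ) (i : Fin n) : ℝ :=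
  if i.val < k then (-1) ^ (n - 1 - i.val) else 0

theorem alternatingVec_zero (n : ℕ) : alternatingVec n 0 = 0 := by
  ext i
  simp [alternatingVec]

theorem alternatingVec_succ {k : ℕ} (hk : k < n) :
    alternatingVec n (k + 1) =
      alternatingVec n k + ((-1) ^ (n - 1 - k) : ℝ) • Pi.single (⟨k, hk⟩ : Fin n) (1 : ℝ) := by
  ext i
  by_cases h : i = ⟨k, hk⟩
  · subst h
    simp [alternatingVec]
  · have h' : i.val ≠ k := fun e => h (Fin.ext e)
    simp only [alternatingVec, Pi.add_apply, Pi.smul_apply, Pi.single_eq_of_ne h, smul_eq_mul,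
      mul_zero, add_zero]
    congr 1
    exact propext (by omega)

/-- The two vectors differ by a combination of the basis vectors with indices in `[k, l)`. -/
theorem alternatingVec_mem_iff (S : Submodule ℝ (Fin n → ℝ)) {k l : ℕ} (hkl : k ≤ l)
    (hl : l ≤ n) (h : ∀ c : Fin n, k ≤ c.val → c.val < l → Pi.single c (1 : ℝ) ∈ S) :
    alternatingVec n k ∈ S ↔ alternatingVec n l ∈ S := by
  induction l, hkl using Nat.le_induction with
  | base => rfl
  | succ l hkl ih =>
    rw [ih (by omega) fun c h1 h2 => h c h1 (by omega), alternatingVec_succ (by omega),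
      Submodule.add_mem_iff_left]
    exact S.smul_mem _ (h _ hkl (by simp))

theorem single_mem_of_alternatingVec_mem (S : Submodule ℝ (Fin n → ℝ)) (c : Fin n)
    (h : alternatingVec n c ∈ S) (h' : alternatingVec n (c + 1) ∈ S) :
    Pi.single c (1 : ℝ) ∈ S := by
  rw [alternatingVec_succ c.isLt, Submodule.add_mem_iff_right _ h] at h'
  exact (S.smul_mem_iff (pow_ne_zero _ (by norm_num))).mp h'

/-- The matrix `(I_n | A')` of a staircase. -/
def staircaseMatrix (n : ℕ) (g : ℕ → ℕ) : Matrix (Fin n) (Fin (2 * n)) ℝ :=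
  Matrix.of fun i c =>
    if c.val < n then (if c.val = i.val then 1 else 0) else alternatingVec n (g c + 1) i

variable {g : ℕ → ℕ}

theorem staircaseMatrix_col_of_lt (x : Fin (2 * n)) (hx : x.val < n) :
    (staircaseMatrix n g).col x = Pi.single ⟨x, hx⟩ 1 := by
  ext i
  simp [staircaseMatrix, hx, Pi.single_apply, Fin.ext_iff, eq_comm]

theorem staircaseMatrix_col_of_ge (x : Fin (2 * n)) (hx : n ≤ x.val) :
    (staircaseMatrix n g).col x = alternatingVec n (g x + 1) := by
  ext i
  simp [staircaseMatrix, not_lt.mpr hx]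

theorem span_staircaseMatrix (n : ℕ) (g : ℕ → ℕ) :
    Submodule.span ℝ (Set.range (staircaseMatrix n g).col) = ⊤ := by
  rw [← top_le_iff, ← (Pi.basisFun ℝ (Fin n)).span_eq]
  refine Submodule.span_mono ?_
  rintro _ ⟨i, rfl⟩
  refine ⟨⟨i, by omega⟩, ?_⟩
  rw [staircaseMatrix_col_of_lt _ i.isLt, Pi.basisFun_apply]

/-- Each column of the matrix of a staircase is generated by the columns that precede it
cyclically, from the one given by the permutation of the staircase on. -/
theorem IsStaircase.col_mem_span (hg : IsStaircase n g) {x a : Fin (2 * n)}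
    (h : StaircaseRel n g x a) :
    (staircaseMatrix n g).col x ∈
      Submodule.span ℝ ((staircaseMatrix n g).col '' {y | (y - a).val < (x - a).val}) := by
  have hn : 0 < n := by have := x.isLt; omega
  have h0 := hg.apply_self hn
  set S := Submodule.span ℝ ((staircaseMatrix n g).col '' {y | (y - a).val < (x - a).val})
    with hS
  have hsub : ∀ y : Fin (2 * n), (y - a).val < (x - a).val → (staircaseMatrix n g).col y ∈ S :=
    fun y hy => Submodule.subset_span ⟨y, hy, rfl⟩
  simp only [Fin.val_sub_eq_ite] at hsub
  have ha := a.isLt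
  have hx := x.isLt
  have hcol : ∀ c : Fin n, ((if a.val ≤ c.val then c.val - a.val else 2 * n + c.val - a.val) <
      if a.val ≤ x.val then x.val - a.val else 2 * n + x.val - a.val) →
      Pi.single c (1 : ℝ) ∈ S := fun c hc => by
    have := hsub ⟨c, by omega⟩ hc
    rwa [staircaseMatrix_col_of_lt _ c.isLt] at this
  have hbig : ∀ y : Fin (2 * n), n ≤ y.val →
      ((if a.val ≤ y.val then y.val - a.val else 2 * n + y.val - a.val) <
      if a.val ≤ x.val then x.val - a.val else 2 * n + x.val - a.val) →
      alternatingVec n (g y + 1) ∈ S := fun y hy hc => by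
    have := hsub y hc
    rwa [staircaseMatrix_col_of_ge _ hy] at this
  have hzero : alternatingVec n 0 ∈ S := by rw [alternatingVec_zero]; exact S.zero_mem
  have hfull := hbig ⟨n, by omega⟩ le_rfl
  rw [show g (⟨n, by omega⟩ : Fin (2 * n)).val + 1 = n by simp only; omega] at hfull
  simp only at hfull
  rcases h with h | h | h | h | h
  -- The arc is the whole identity block, which generates the full alternating vector.
  · rw [staircaseMatrix_col_of_ge _ h.1.ge, h.1, show g n + 1 = n by omega,
      ← alternatingVec_mem_iff S (Nat.zero_le n) le_rfl]
    · exact hzero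
    · intro c _ hc
      refine hcol c ?_
      split_ifs <;> omega
  -- The arc omits only `x`. Here `e_x` is, up to sign, a difference of consecutive alternating
  -- vectors: the shorter comes from the earlier basis vectors, the longer from column `n` and the
  -- later basis vectors.
  · have hc := h.2.1 n le_rfl (by omega)
    rw [staircaseMatrix_col_of_lt _ h.1]
    refine single_mem_of_alternatingVec_mem S ⟨x, h.1⟩ ?_ ?_
    · rw [← alternatingVec_mem_iff S (Nat.zero_le _) (by simp only; omega)]
      · exact hzero
      · intro c _ hc'
        simp only at hc'
        refine hcol c ?_
        split_ifs <;> omega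
    · rw [alternatingVec_mem_iff S (l := n) (by simp only; omega) le_rfl]
      · refine hfull ?_
        split_ifs <;> omega
      · intro c hc' _
        simp only at hc'
        refine hcol c ?_
        have := c.isLt
        split_ifs <;> omega
  -- The arc starts at `a`, whose column is the alternating vector of length `x + 1`, and wraps
  -- around through the basis vectors before `x`.
  · rw [staircaseMatrix_col_of_lt _ h.1]
    refine single_mem_of_alternatingVec_mem S ⟨x, h.1⟩ ?_ ?_
    · rw [← alternatingVec_mem_iff S (Nat.zero_le _) (by simp only; omega)]
      · exact hzero
      · intro c _ hc'
        simp only at hc'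
        refine hcol c ?_
        split_ifs <;> omega
    · have := hbig a h.2.1 (by split_ifs <;> omega)
      rwa [h.2.2.2.1] at this
  · rw [staircaseMatrix_col_of_ge _ h.1.le, h.2.2.1, ← h.2.2.2]
    exact hbig a (by omega) (by split_ifs <;> omega)
  -- Column `x` is column `n` truncated after row `g x`; the arc contains column `n` and the basis
  -- vectors that are removed.
  · have hlt := hg.lt x h.1.le h.2.1
    rw [staircaseMatrix_col_of_ge _ h.1.le, alternatingVec_mem_iff S (l := n) (by omega) le_rfl]
    · refine hfull ?_
      have := hg.anti (x - 1) x (by omega) (by omega) h.2.1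
      have := hg.lt (x - 1) (by omega) (by omega)
      split_ifs <;> omega
    · intro c hc _
      refine hcol c ?_
      have := c.isLt
      split_ifs <;> omega

theorem IsStaircase.isNecklaceOf (hg : IsStaircase n g) {M : Matroid (Fin (2 * n))}
    {π : Equiv.Perm (Fin (2 * n))} (hπ : ∀ x : Fin (2 * n), StaircaseRel n g x (π x))
    (hM : ∀ B : Set (Fin (2 * n)), M.IsBase B ↔
      LinearIndepOn ℝ (staircaseMatrix n g).col B ∧
        Submodule.span ℝ ((staircaseMatrix n g).col '' B) = ⊤) :
    IsNecklaceOf M (necklaceOfPerm π) := by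
  refine isNecklaceOf_necklaceOfPerm hM (span_staircaseMatrix n g)
    (fun x h => hg.rel_ne (by omega) (hπ x) (congrArg Fin.val h)) ?_
    (fun x => hg.col_mem_span (hπ x))
  have h1 : (Finset.univ.filter fun x => x < π x) =
      Finset.univ.map (Fin.castLEEmb (show n ≤ 2 * n by omega)) := by
    ext x
    have := x.isLt
    rw [Finset.mem_filter, Fin.lt_def, hg.rel_lt_iff (by omega) (hπ x)]
    simp only [Finset.mem_univ, true_and, Finset.mem_map, Fin.castLEEmb_apply]
    exact ⟨fun h => ⟨⟨x, h⟩, rfl⟩, by rintro ⟨y, rfl⟩; exact y.isLt⟩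
  rw [h1, Finset.card_map, Finset.card_univ, Fintype.card_fin]

end StaircaseColumns

/-! ### Nonnegativity of the maximal minors. -/

section Minors

variable {n : ℕ} {g : ℕ → ℕ}

/-- A square matrix whose first `k` columns are the standard basis vectors with indices `c j` and
whose other columns are alternating vectors of lengths `b j`. -/
def staircaseMinor (n k : ℕ) (c b : ℕ → ℕ) : Matrix (Fin n) (Fin n) ℝ :=
  Matrix.of fun i j =>
    if j.val < k then (if c j = i.val then 1 else 0) else alternatingVec n (b j) i

/-- Signs are counted from the last coordinate, so deleting the first coordinate only shortens the
vector. -/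
theorem alternatingVec_succ_succ (n b : ℕ) (i : Fin n) :
    alternatingVec (n + 1) b i.succ = alternatingVec n (b - 1) i := by
  unfold alternatingVec
  congr 1
  · exact propext (by rw [Fin.val_succ]; omega)
  · rw [Fin.val_succ]; congr 1; omega

/-- Induction on the size, by the top two rows. If `e_0` is the first column, or the last column is
supported on row 0, expanding along it gives a smaller minor of the same kind. Otherwise the
determinant is zero because of a zero row or column, or all alternating columns have length at least
2. Then rows 0 and 1 are opposite on the alternating columns: either they are opposite everywhere
and the determinant vanishes, or the first column is `e_1` and expansion along it works. -/
theorem det_staircaseMinor_nonneg (n k : ℕ) (c b : ℕ → ℕ)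
    (hc : ∀ i j, i < j → j < k → c i < c j) (hb : ∀ i j, k ≤ i → i ≤ j → j < n → b j ≤ b i) :
    0 ≤ (staircaseMinor n k c b).det := by
  induction n generalizing k c b with
  | zero => simp
  | succ n ih =>
    have hcpos : ∀ j, 0 < j → j < k → 0 < c j := fun j h1 h2 =>
      (Nat.zero_le _).trans_lt (hc 0 j h1 h2)
    by_cases hA : 0 < k ∧ c 0 = 0
    · have key := ih (k - 1) (fun j => c (j + 1) - 1) (fun j => b (j + 1) - 1)
        (fun i j h1 h2 => by
          have := hc (i + 1) (j + 1) (by omega) (by omega)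
          have := hcpos (i + 1) (by omega) (by omega)
          omega)
        (fun i j h1 h2 h3 => by
          have := hb (i + 1) (j + 1) (by omega) (by omega) (by omega)
          omega)
      rw [Matrix.det_succ_column _ 0, Finset.sum_eq_single 0]
      · convert key using 1
        have : (staircaseMinor (n + 1) k c b).submatrix (Fin.succAbove 0) (Fin.succAbove 0) =
            staircaseMinor n (k - 1) (fun j => c (j + 1) - 1) (fun j => b (j + 1) - 1) := by
          ext i j
          simp only [staircaseMinor, Fin.succAbove_zero, Matrix.submatrix_apply, Matrix.of_apply,
            alternatingVec_succ_succ, Fin.val_succ]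
          by_cases hj : j.val + 1 < k
          · have := hcpos (j + 1) (by omega) hj
            rw [if_pos hj, if_pos (show j.val < k - 1 by omega)]
            congr 1
            exact propext (by omega)
          · rw [if_neg hj, if_neg (show ¬ j.val < k - 1 by omega)]
        rw [this]
        simp [staircaseMinor, hA]
      · intro i _ hi
        have : (0 : ℕ) ≠ i.val := fun h => hi (Fin.ext h.symm)
        simp [staircaseMinor, hA, this]
      · simp
    have hc0 : ∀ j, j < k → 0 < c j := fun j hj => by
      rcases Nat.eq_zero_or_pos j with rfl | h
      · by_contra h0
        exact hA ⟨hj, by omega⟩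
      · exact hcpos j h hj
    by_cases hk : n < k
    · refine (Matrix.det_eq_zero_of_row_eq_zero 0 fun j => ?_).ge
      have := hc0 j (by omega)
      simp [staircaseMinor, show j.val < k by omega, this.ne']
    by_cases hb0 : b n = 0
    · refine (Matrix.det_eq_zero_of_column_eq_zero (Fin.last n) fun i => ?_).ge
      simp [staircaseMinor, hk, hb0, alternatingVec]
    by_cases hb1 : b n = 1 ∨ n = 0
    · have key := ih k (fun j => c j - 1) (fun j => b j - 1)
        (fun i j h1 h2 => by
          have := hc i j h1 h2
          have := hc0 i (by omega)
          omega)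
        (fun i j h1 h2 h3 => by
          have := hb i j h1 h2 (by omega)
          omega)
      rw [Matrix.det_succ_column _ (Fin.last n), Finset.sum_eq_single 0]
      · convert key using 1
        have : (staircaseMinor (n + 1) k c b).submatrix (Fin.succAbove 0)
            (Fin.succAbove (Fin.last n)) =
            staircaseMinor n k (fun j => c j - 1) (fun j => b j - 1) := by
          ext i j
          simp only [staircaseMinor, Fin.succAbove_zero, Fin.succAbove_last,
            Matrix.submatrix_apply, Matrix.of_apply, alternatingVec_succ_succ, Fin.val_succ,
            Fin.val_castSucc]
          by_cases hj : j.val < k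
          · have := hc0 j hj
            rw [if_pos hj, if_pos hj]
            congr 1
            exact propext (by omega)
          · rw [if_neg hj, if_neg hj]
        rw [this]
        -- The entry and its cofactor both carry the sign `(-1) ^ n`.
        simp [staircaseMinor, hk, alternatingVec, Nat.pos_of_ne_zero hb0, ← pow_add,
          ← two_mul]
      · intro i _ hi
        have h1 : i.val ≠ 0 := fun h => hi (Fin.ext h)
        have h2 : ¬ i.val < b n := by have := i.isLt; omega
        simp [staircaseMinor, hk, alternatingVec, h2]
      · simp
    obtain ⟨l, rfl⟩ : ∃ l, n = l + 1 := ⟨n - 1, by omega⟩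
    have hb2 : ∀ j, k ≤ j → j < l + 2 → 2 ≤ b j := fun j h1 h2 => by
      have := hb j (l + 1) h1 (by omega) (by omega)
      omega
    by_cases hc1 : 0 < k ∧ c 0 = 1
    · have hc2 : ∀ j, 0 < j → j < k → 1 < c j := fun j h1 h2 => by
        have := hc 0 j h1 h2
        omega
      have key := ih (k - 1) (fun j => c (j + 1) - 1) (fun j => b (j + 1) - 1)
        (fun i j h1 h2 => by
          have := hc (i + 1) (j + 1) (by omega) (by omega)
          have := hcpos (i + 1) (by omega) (by omega)
          omega)
        (fun i j h1 h2 h3 => by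
          have := hb (i + 1) (j + 1) (by omega) (by omega) (by omega)
          omega)
      rw [Matrix.det_succ_column _ 0, Finset.sum_eq_single 1]
      · convert key using 1
        -- After row 1 is deleted, row 0 takes its place with the opposite sign, which cancels the
        -- cofactor sign.
        have : (staircaseMinor (l + 2) k c b).submatrix (Fin.succAbove 1) (Fin.succAbove 0) =
            (staircaseMinor (l + 1) (k - 1) (fun j => c (j + 1) - 1)
              (fun j => b (j + 1) - 1)).updateRow 0 ((-1 : ℝ) • staircaseMinor (l + 1) (k - 1)
                (fun j => c (j + 1) - 1) (fun j => b (j + 1) - 1) 0) := by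
          ext i j
          induction i using Fin.cases with
          | zero =>
            simp only [staircaseMinor, Fin.succAbove_zero, Matrix.submatrix_apply, Matrix.of_apply,
              Fin.val_succ, Matrix.updateRow_self, Pi.smul_apply, alternatingVec]
            by_cases hj : j.val + 1 < k
            · have := hc2 (j + 1) (by omega) hj
              rw [if_pos hj, if_pos (show j.val < k - 1 by omega), if_neg, if_neg]
              · simp
              · simp; omega
              · simp; omega
            · have := hb2 (j + 1) (by omega) (by omega)
              rw [if_neg hj, if_neg (show ¬ j.val < k - 1 by omega), if_pos, if_pos]
              · simp [pow_succ]
              · simp; omega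
              · simp; omega
          | succ i =>
            have e : (Fin.succAbove (1 : Fin (l + 2)) i.succ) = i.succ.succ := by
              rw [← Fin.succ_zero_eq_one, Fin.succ_succAbove_succ, Fin.succAbove_zero]
            rw [Matrix.submatrix_apply, e, Matrix.updateRow_ne (Fin.succ_ne_zero i)]
            simp only [staircaseMinor, Fin.succAbove_zero, Matrix.of_apply,
              alternatingVec_succ_succ, Fin.val_succ]
            by_cases hj : j.val + 1 < k
            · have := hcpos (j + 1) (by omega) hj
              rw [if_pos hj, if_pos (show j.val < k - 1 by omega)]
              congr 1
              exact propext (by omega)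
            · rw [if_neg hj, if_neg (show ¬ j.val < k - 1 by omega)]
        rw [this, Matrix.det_updateRow_smul, Matrix.updateRow_eq_self]
        simp [staircaseMinor, hc1]
      · intro i _ hi
        have : (1 : ℕ) ≠ i.val := fun h => hi (Fin.ext h.symm)
        simp [staircaseMinor, hc1, this]
      · simp
    · refine le_of_eq ?_
      symm
      have hrow : staircaseMinor (l + 2) k c b 1 = (-1 : ℝ) • staircaseMinor (l + 2) k c b 0 := by
        ext j
        simp only [staircaseMinor, Matrix.of_apply, Pi.smul_apply, alternatingVec]
        by_cases hj : j.val < k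
        · have h0 := hc0 j hj
          have h1 : c j ≠ 1 := fun h => by
            rcases Nat.eq_zero_or_pos j.val with h2 | h2
            · rw [h2] at h; exact hc1 ⟨by omega, h⟩
            · have := hc 0 j h2 hj
              have := hc0 0 (by omega)
              omega
          simp [hj, h0.ne', h1]
        · have := hb2 j (by omega) j.isLt
          rw [if_neg hj, if_neg hj, if_pos, if_pos]
          · simp [pow_succ]
          · simp; omega
          · simp; omega
      rw [← Matrix.updateRow_eq_self (staircaseMinor (l + 2) k c b) 1, hrow,
        Matrix.det_updateRow_smul, Matrix.det_zero_of_row_eq (i := 1) (j := 0) (by simp)]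
      · simp
      · simp

theorem staircaseMatrix_mem_matNonneg (hg : IsStaircase n g) :
    staircaseMatrix n g ∈ matNonneg n (2 * n) := by
  refine ⟨?_, fun f => ?_⟩
  · rw [Matrix.rank_eq_finrank_span_cols, span_staircaseMatrix, finrank_top]
    simp
  · have hex : ∃ k, ∀ j : Fin n, (f j).val < n → j.val < k := ⟨n, fun j _ => j.isLt⟩
    -- The number of selected columns in the identity block; they come first because `f` is
    -- increasing.
    let k := Nat.find hex
    have hk1 : ∀ j : Fin n, (f j).val < n → j.val < k := Nat.find_spec hex
    have hk2 : ∀ j : Fin n, j.val < k → (f j).val < n := fun j hj => by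
      by_contra hcon
      refine Nat.find_min hex hj fun i hi => ?_
      by_contra hij
      have : (f j).val ≤ (f i).val := Fin.le_def.mp (f.monotone (Fin.le_def.mpr (not_lt.mp hij)))
      omega
    have hkn : k ≤ n := Nat.find_min' hex fun j _ => j.isLt
    let F : ℕ → ℕ := fun j => if h : j < n then (f ⟨j, h⟩).val else 0
    have hF : ∀ j (h : j < n), F j = (f ⟨j, h⟩).val := fun j h => dif_pos h
    have : (staircaseMatrix n g).submatrix id f =
        staircaseMinor n k F (fun j => g (F j) + 1) := by
      ext i j
      simp only [staircaseMatrix, staircaseMinor, Matrix.submatrix_apply, Matrix.of_apply, id,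
        hF j j.isLt, Fin.eta]
      congr 1
      exact propext ⟨hk1 j, hk2 j⟩
    rw [this]
    refine det_staircaseMinor_nonneg n k _ _ (fun i j h1 h2 => ?_) (fun i j h1 h2 h3 => ?_)
    · rw [hF i (by omega), hF j (by omega)]
      exact Fin.lt_def.mp (f.strictMono (Fin.lt_def.mpr h1))
    · rw [hF i (by omega), hF j (by omega)]
      have h4 : n ≤ (f ⟨i, by omega⟩).val := by
        by_contra h
        have := hk1 _ (not_le.mp h)
        simp only at this
        omega
      have h5 : (f ⟨i, by omega⟩).val ≤ (f ⟨j, h3⟩).val :=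
        Fin.le_def.mp (f.monotone (Fin.le_def.mpr h2))
      have := hg.anti _ _ h4 h5 (f ⟨j, h3⟩).isLt
      omega

end Minors

/-! ### Unit interval orders correspond to staircases. -/

section UnitIntervalOrders

theorem exists_forall_iff_val_lt {n : ℕ} (S : Fin n → Prop)
    (hS : ∀ r r' : Fin n, r' ≤ r → S r → S r') : ∃ k, ∀ r, S r ↔ r.val < k := by
  classical
  have hex : ∃ k, ∀ r, S r → r.val < k := ⟨n, fun r _ => r.isLt⟩
  refine ⟨Nat.find hex, fun r => ⟨Nat.find_spec hex r, fun hr => ?_⟩⟩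
  by_contra hcon
  refine Nat.find_min hex hr fun s hs => ?_
  by_contra h
  exact hcon (hS s r (Fin.le_def.mpr (not_lt.mp h)) hs)

variable {P : Type} [PartialOrder P]

theorem ncard_Iic_eq [Finite P] (x : P) : (Set.Iic x).ncard = (Set.Iio x).ncard + 1 := by
  rw [← Set.Iio_insert, Set.ncard_insert_of_notMem (by simp) (Set.toFinite _)]

theorem ncard_Ici_eq [Finite P] (x : P) : (Set.Ici x).ncard = (Set.Ioi x).ncard + 1 := by
  rw [← Set.Ioi_insert, Set.ncard_insert_of_notMem (by simp) (Set.toFinite _)]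

theorem altitude_eq [Finite P] (x : P) :
    altitude x = (Set.Iio x).ncard - (Set.Ioi x).ncard := by
  rw [altitude, ncard_Iic_eq, ncard_Ici_eq]
  push_cast
  ring

section Intervals

variable {q : P → ℝ} (hq : ∀ i j : P, i < j ↔ q i + 1 < q j)
include hq

theorem Iio_subset_Iio_of_interval_le {x y : P} (h : q x ≤ q y) : Set.Iio x ⊆ Set.Iio y :=
  fun z hz => (hq z y).mpr (((hq z x).mp hz).trans_le h)

theorem Ioi_subset_Ioi_of_interval_le {x y : P} (h : q x ≤ q y) : Set.Ioi y ⊆ Set.Ioi x :=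
  fun z hz => (hq x z).mpr (lt_of_le_of_lt (by linarith) ((hq y z).mp hz))

theorem altitude_le_of_interval_le [Finite P] {x y : P} (h : q x ≤ q y) :
    altitude x ≤ altitude y := by
  have h1 := Set.ncard_le_ncard (Iio_subset_Iio_of_interval_le hq h) (Set.toFinite _)
  have h2 := Set.ncard_le_ncard (Ioi_subset_Ioi_of_interval_le hq h) (Set.toFinite _)
  rw [altitude_eq, altitude_eq]
  omega

/-- If the endpoints are ordered against the altitudes, the nested sets have equal cardinalities and
so coincide. Thus a canonical labeling can replace the order of the intervals. -/
theorem interval_subset_of_altitude_le [Finite P] {x y : P} (h : altitude x ≤ altitude y) :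
    Set.Iio x ⊆ Set.Iio y ∧ Set.Ioi y ⊆ Set.Ioi x := by
  rcases le_total (q x) (q y) with hxy | hxy
  · exact ⟨Iio_subset_Iio_of_interval_le hq hxy, Ioi_subset_Ioi_of_interval_le hq hxy⟩
  · have s1 := Iio_subset_Iio_of_interval_le hq hxy
    have s2 := Ioi_subset_Ioi_of_interval_le hq hxy
    have h1 := Set.ncard_le_ncard s1 (Set.toFinite _)
    have h2 := Set.ncard_le_ncard s2 (Set.toFinite _)
    rw [altitude_eq, altitude_eq] at h
    exact ⟨(Set.eq_of_subset_of_ncard_le s1 (by omega) (Set.toFinite _)).ge,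
      (Set.eq_of_subset_of_ncard_le s2 (by omega) (Set.toFinite _)).ge⟩

end Intervals

/-- The columns of the matrix of a canonically labeled unit interval order form a staircase. -/
theorem exists_staircaseMatrix_eq {n : ℕ} (l : P ≃ Fin n) (hP : IsUnitIntervalOrder P)
    (hl : IsCanonicalLabeling l) :
    ∃ g, IsStaircase n g ∧ psiMatrix (antiadjacencyMatrix l) = staircaseMatrix n g := by
  classical
  have := Finite.of_equiv _ l.symm
  obtain ⟨q, -, hq⟩ := hP
  have halt : ∀ i j : Fin n, i ≤ j → altitude (l.symm i) ≤ altitude (l.symm j) := fun i j hij => by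
    by_contra h
    have := hl _ _ (not_le.mp h)
    rw [Equiv.apply_symm_apply, Equiv.apply_symm_apply] at this
    exact absurd hij (not_le.mpr this)
  choose t ht using fun j : Fin n => exists_forall_iff_val_lt (fun r => l.symm r < l.symm j)
    fun r r' hr h => (interval_subset_of_altitude_le hq (halt r' r hr)).2 h
  have htle : ∀ j : Fin n, t j ≤ j := fun j => by
    by_contra h
    exact lt_irrefl _ ((ht j j).mpr (not_le.mp h))
  have htmono : ∀ i j : Fin n, i ≤ j → t i ≤ t j := fun i j hij => by
    by_contra h
    have h1 := (ht i ⟨t j, by have := htle i; omega⟩).mpr (not_le.mp h)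
    exact lt_irrefl _ ((ht j _).mp ((interval_subset_of_altitude_le hq (halt i j hij)).1 h1))
  -- The zeros of column `j` of `A` fill its first `t j` rows. Upside down they fill the last `t j`,
  -- so the last nonzero row is `n - 1 - t j`; the value 0 is a filler outside the label range.
  refine ⟨fun x => if h : x - n < n then n - 1 - t ⟨x - n, h⟩ else 0, ⟨?_, ?_, ?_⟩, ?_⟩
  · intro x h1 h2
    rw [dif_pos (by omega)]
    omega
  · intro x h1 h2
    rw [dif_pos (by omega)]
    have := htle ⟨x - n, by omega⟩
    simp only at this
    omega
  · intro x y h1 h2 h3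
    rw [dif_pos (by omega), dif_pos (by omega)]
    have := htmono ⟨x - n, by omega⟩ ⟨y - n, by omega⟩ (Fin.le_def.mpr (by simp only; omega))
    omega
  · ext i c
    simp only [psiMatrix, staircaseMatrix, Matrix.of_apply]
    by_cases hc : c.val < n
    · rw [dif_pos hc, if_pos hc]
    · have hc' : c.val - n < n := by have := c.isLt; omega
      rw [dif_neg hc, if_neg hc, dif_pos hc', antiadjacencyMatrix, Matrix.of_apply,
        alternatingVec]
      have h1 := ht ⟨c.val - n, hc'⟩ i.rev
      have h2 := htle ⟨c.val - n, hc'⟩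
      rw [Fin.val_rev] at h1
      simp only at h2
      have h3 := i.isLt
      by_cases h : l.symm i.rev < l.symm ⟨c.val - n, hc'⟩
      · rw [if_pos h, if_neg (by rw [h1] at h; omega), mul_zero]
      · rw [if_neg h, if_pos (by rw [h1] at h; omega), mul_one]

/-- The order on the indices of a family of unit intervals. -/
abbrev intervalPartialOrder {α : Type} (q : α → ℝ) : PartialOrder α where
  le i j := i = j ∨ q i + 1 < q j
  lt i j := q i + 1 < q j
  le_refl i := Or.inl rfl
  le_trans i j k := by
    rintro (rfl | h) (rfl | h')
    · exact Or.inl rfl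
    · exact Or.inr h'
    · exact Or.inr h
    · exact Or.inr (by linarith)
  lt_iff_le_not_ge i j := by
    constructor
    · intro h
      refine ⟨Or.inr h, ?_⟩
      rintro (rfl | h')
      · linarith
      · linarith
    · rintro ⟨rfl | h, h'⟩
      · exact absurd (Or.inl rfl) h'
      · exact h
  le_antisymm i j := by
    rintro (rfl | h) (h' | h')
    · rfl
    · rfl
    · exact h'.symm
    · linarith

/-- Unit intervals realizing prescribed comparabilities `i < j ↔ i < t j`. -/
theorem exists_unit_intervals (n : ℕ) (t : ℕ → ℕ) (ht : ∀ j, j < n → t j ≤ j)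
    (hmono : ∀ i j, i ≤ j → j < n → t i ≤ t j) :
    ∃ q : ℕ → ℝ, (∀ i j, i < j → j < n → q i < q j) ∧
      ∀ i j, i < j → j < n → (i < t j → q i + 1 < q j) ∧ (t j ≤ i → q j < q i + 1) := by
  induction n with
  | zero => exact ⟨0, by simp, by simp⟩
  | succ n ih =>
    obtain ⟨q, h1, h2⟩ := ih (fun j hj => ht j (by omega)) fun i j h h' => hmono i j h (by omega)
    have hmn : ∀ i j, i ≤ j → j < n → q i ≤ q j := fun i j h h' => by
      rcases h.eq_or_lt with rfl | h
      · rfl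
      · exact (h1 i j h h').le
    -- The new left endpoint has finitely many lower bounds `F` and upper bounds `G`; by density it
    -- exists once each lower bound is below each upper bound.
    obtain ⟨y, hy1, hy2, hy3⟩ : ∃ y : ℝ, (∀ i, i < n → q i < y) ∧
        (∀ i, i < t n → q i + 1 < y) ∧ ∀ i, i < n → t n ≤ i → y < q i + 1 := by
      have htn := ht n (by omega)
      let F : Finset ℝ := (Finset.range n).image q ∪ (Finset.range (t n)).image fun i => q i + 1
      let G : Finset ℝ := (Finset.Ico (t n) n).image fun i => q i + 1
      obtain ⟨y, hy, hy'⟩ : ∃ y, (∀ x ∈ F, x < y) ∧ ∀ z ∈ G, y < z := by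
        refine Order.exists_between_finsets F G ?_
        intro x hx z hz
        simp only [F, G, Finset.mem_union, Finset.mem_image, Finset.mem_range,
          Finset.mem_Ico] at hx hz
        obtain ⟨j, ⟨hj1, hj2⟩, rfl⟩ := hz
        rcases hx with ⟨i, hi, rfl⟩ | ⟨i, hi, rfl⟩
        · rcases le_or_gt i j with hij | hij
          · linarith [hmn i j hij hj2]
          -- Since `t i ≤ t n ≤ j`, the intervals of `j` and `i` already meet.
          · exact (h2 j i hij hi).2 ((hmono i n hi.le (by omega)).trans hj1)
        · linarith [h1 i j (by omega) hj2]
      refine ⟨y, fun i hi => hy _ ?_, fun i hi => hy _ ?_, fun i hi hi' => hy' _ ?_⟩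
      · exact Finset.mem_union_left _ (Finset.mem_image_of_mem q (Finset.mem_range.mpr hi))
      · exact Finset.mem_union_right _
          (Finset.mem_image_of_mem (fun i => q i + 1) (Finset.mem_range.mpr hi))
      · exact Finset.mem_image_of_mem (fun i => q i + 1) (Finset.mem_Ico.mpr ⟨hi', hi⟩)
    refine ⟨Function.update q n y, fun i j hij hj => ?_, fun i j hij hj => ?_⟩
    · rw [Function.update_of_ne (show i ≠ n by omega)]
      rcases Nat.lt_succ_iff_lt_or_eq.mp hj with hj | rfl
      · rw [Function.update_of_ne hj.ne]
        exact h1 i j hij hj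
      · rw [Function.update_self]
        exact hy1 i hij
    · rw [Function.update_of_ne (show i ≠ n by omega)]
      rcases Nat.lt_succ_iff_lt_or_eq.mp hj with hj | rfl
      · rw [Function.update_of_ne hj.ne]
        exact h2 i j hij hj
      · rw [Function.update_self]
        exact ⟨hy2 i, hy3 i hij⟩

/-- Every staircase comes from a canonically labeled unit interval order. -/
theorem IsStaircase.exists_unitIntervalOrder {n : ℕ} {g : ℕ → ℕ} (hg : IsStaircase n g) :
    ∃ (P : Type) (_ : PartialOrder P) (l : P ≃ Fin n), IsUnitIntervalOrder P ∧
      IsCanonicalLabeling l ∧ psiMatrix (antiadjacencyMatrix l) = staircaseMatrix n g := by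
  classical
  obtain ⟨q, hq1, hq2⟩ := exists_unit_intervals n (fun j => n - 1 - g (n + j))
    (fun j hj => by have := hg.diag_le (n + j) (by omega) (by omega); omega)
    (fun i j hij hj => by have := hg.anti (n + i) (n + j) (by omega) (by omega) (by omega); omega)
  have hmono : StrictMono fun i : Fin n => q i := fun i j hij => hq1 i j hij j.isLt
  have hle : ∀ i j : Fin n, i.val ≤ j.val → q i ≤ q j := fun i j hij =>
    hmono.monotone (Fin.le_def.mpr hij)
  -- The order is passed explicitly, since `Fin n` carries its own.
  have hA : ∀ i j : Fin n, @antiadjacencyMatrix (Fin n) (intervalPartialOrder fun i : Fin n => q i)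
      n (Equiv.refl _) i j = @ite _ (q i + 1 < q j) (Classical.propDecidable _) (0 : ℝ) 1 :=
    fun i j => rfl
  have hlt : ∀ i j : Fin n, @LT.lt (Fin n) (intervalPartialOrder fun i : Fin n => q i).toLT i j ↔
      q i + 1 < q j := fun i j => Iff.rfl
  refine ⟨Fin n, intervalPartialOrder fun i => q i, Equiv.refl _,
    ⟨fun i => q i, fun i j hij => ?_, hlt⟩, fun i j hij => ?_, ?_⟩
  · exact hmono.injective ((Set.Icc_eq_Icc_iff (by linarith)).mp hij).1
  · by_contra h
    refine absurd hij (not_lt.mpr ?_)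
    exact @altitude_le_of_interval_le _ (intervalPartialOrder fun i : Fin n => q i) _ hlt _ _ _
      (hle _ _ (Fin.le_def.mp (not_lt.mp h)))
  · ext i c
    simp only [psiMatrix, staircaseMatrix, Matrix.of_apply]
    by_cases hc : c.val < n
    · rw [dif_pos hc, if_pos hc]
    · have hc' : c.val < 2 * n := c.isLt
      have hi := i.isLt
      rw [dif_neg hc, if_neg hc, hA, alternatingVec]
      have e : n + (c.val - n) = c.val := by omega
      have h0 := hg.lt c (by omega) hc'
      have h0' := hg.diag_le c (by omega) hc'
      have hr : i.rev.val = n - (i.val + 1) := Fin.val_rev i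
      have h1 : q i.rev + 1 < q (c.val - n) ↔ g c < i.val := by
        rcases lt_or_ge i.rev.val (c.val - n) with h | h
        · have h2 := hq2 i.rev (c.val - n) h (by omega)
          simp only [e] at h2
          constructor
          · intro h3
            by_contra h4
            linarith [h2.2 (by omega)]
          · intro h3
            exact h2.1 (by omega)
        · refine iff_of_false ?_ (by omega)
          have : q (c.val - n) ≤ q i.rev := hle ⟨c.val - n, by omega⟩ i.rev h
          linarith
      by_cases h : g c < i.val
      · rw [if_pos (h1.mpr h), if_neg (by omega), mul_zero]
      · rw [if_neg (fun h' => h (h1.mp h')), if_pos (by omega), mul_one]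

end UnitIntervalOrders

/-! ### Pipes in square Le-diagrams. -/

namespace LeDiagram

/-- The shape of the Le-diagram is the full `n × n` square. -/
def IsSquare {n : ℕ} (L : LeDiagram n (2 * n)) : Prop :=
  ∀ i j : ℕ, (i, j) ∈ L.shape.cells ↔ i < n ∧ j < n

section PipeSteps

variable {n : ℕ} {L : LeDiagram n (2 * n)}

theorem IsSquare.rowLabel_eq (hL : L.IsSquare) {i : ℕ} (hi : i < n) : L.rowLabel i = i := by
  have : L.shape.rowLen i = n := eq_of_forall_lt_iff fun j => by
    rw [← YoungDiagram.mem_iff_lt_rowLen, ← YoungDiagram.mem_cells, hL]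
    exact and_iff_right hi
  rw [rowLabel, this]
  omega

theorem IsSquare.colLabel_eq (hL : L.IsSquare) {j : ℕ} (hj : j < n) :
    L.colLabel j = 2 * n - 1 - j := by
  have : L.shape.colLen j = n := eq_of_forall_lt_iff fun i => by
    rw [← YoungDiagram.mem_iff_lt_colLen, ← YoungDiagram.mem_cells, hL]
    exact and_iff_left hj
  rw [colLabel, this]
  omega

theorem IsSquare.lt_of_mem (hL : L.IsSquare) {i j : ℕ} (h : (i, j) ∈ L.pluses) :
    i < n ∧ j < n :=
  (hL i j).mp (L.pluses_subset h)

theorem pipeExit_south_of_mem {i j : ℕ} (h : (i, j) ∈ L.pluses) :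
    L.pipeExit i j .south = L.pipeExit i (j + 1) .east := by
  conv_lhs => rw [pipeExit, dif_pos (L.pluses_subset h), if_pos h]

theorem pipeExit_east_of_mem {i j : ℕ} (h : (i, j) ∈ L.pluses) :
    L.pipeExit i j .east = L.pipeExit (i + 1) j .south := by
  conv_lhs => rw [pipeExit, dif_pos (L.pluses_subset h), if_pos h]

theorem pipeExit_south_of_notMem {i j : ℕ} (hc : (i, j) ∈ L.shape.cells) (h : (i, j) ∉ L.pluses) :
    L.pipeExit i j .south = L.pipeExit (i + 1) j .south := by
  conv_lhs => rw [pipeExit, dif_pos hc, if_neg h]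

theorem pipeExit_east_of_notMem {i j : ℕ} (hc : (i, j) ∈ L.shape.cells) (h : (i, j) ∉ L.pluses) :
    L.pipeExit i j .east = L.pipeExit i (j + 1) .east := by
  conv_lhs => rw [pipeExit, dif_pos hc, if_neg h]

theorem IsSquare.pipeExit_south_last (hL : L.IsSquare) {j : ℕ} (hj : j < n) :
    L.pipeExit n j .south = 2 * n - 1 - j := by
  rw [pipeExit, dif_neg (by rw [hL]; omega)]
  exact hL.colLabel_eq hj

theorem IsSquare.pipeExit_east_last (hL : L.IsSquare) {i : ℕ} (hi : i < n) :
    L.pipeExit i n .east = i := by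
  rw [pipeExit, dif_neg (by rw [hL]; omega)]
  exact hL.rowLabel_eq hi

theorem IsSquare.pipeExit_south_straight (hL : L.IsSquare) {i i' j : ℕ} (hii : i ≤ i')
    (hi : i' ≤ n) (hj : j < n) (h : ∀ k, i ≤ k → k < i' → (k, j) ∉ L.pluses) :
    L.pipeExit i j .south = L.pipeExit i' j .south := by
  induction i', hii using Nat.le_induction with
  | base => rfl
  | succ k hk ih =>
    rw [ih (by omega) fun l h1 h2 => h l h1 (by omega)]
    exact pipeExit_south_of_notMem ((hL _ _).mpr ⟨by omega, hj⟩) (h k hk (by omega))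

theorem IsSquare.pipeExit_east_straight (hL : L.IsSquare) {i j j' : ℕ} (hjj : j ≤ j')
    (hj : j' ≤ n) (hi : i < n) (h : ∀ k, j ≤ k → k < j' → (i, k) ∉ L.pluses) :
    L.pipeExit i j .east = L.pipeExit i j' .east := by
  induction j', hjj using Nat.le_induction with
  | base => rfl
  | succ k hk ih =>
    rw [ih (by omega) fun l h1 h2 => h l h1 (by omega)]
    exact pipeExit_east_of_notMem ((hL _ _).mpr ⟨hi, by omega⟩) (h k hk (by omega))

end PipeSteps

section Staircase

variable {n : ℕ} {L : LeDiagram n (2 * n)} {g : ℕ → ℕ}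

/-- The pluses of the Le-diagram are those of a staircase: the column labeled `x` has a plus in
row `g x`, and the last column is full. -/
def HasStaircase (L : LeDiagram n (2 * n)) (g : ℕ → ℕ) : Prop :=
  ∀ i j : ℕ, (i, j) ∈ L.pluses ↔ i < n ∧ j < n ∧ (i = g (2 * n - 1 - j) ∨ j + 1 = n)

/-- The pipes of a staircase. -/
theorem HasStaircase.pipeExit_eq (hLg : L.HasStaircase g) (hL : L.IsSquare)
    (hg : IsStaircase n g) (hn : 0 < n) {x y : ℕ} (h : StaircaseRel n g x y) :
    (x < n → L.pipeExit x 0 .east = y) ∧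
      (n ≤ x → x < 2 * n → L.pipeExit 0 (2 * n - 1 - x) .south = y) := by
  have h0 := hg.apply_self hn
  -- In the full last column the pipe turns south and at once east again in the next row; from the
  -- bottom row it leaves below, at label `n`.
  have hlast : ∀ i, i < n → L.pipeExit i (n - 1) .east = i + 1 := fun i hi => by
    rw [pipeExit_east_of_mem ((hLg _ _).mpr ⟨hi, by omega, Or.inr (by omega)⟩)]
    rcases Nat.lt_or_ge (i + 1) n with h | h
    · rw [pipeExit_south_of_mem ((hLg _ _).mpr ⟨h, by omega, Or.inr (by omega)⟩),
        Nat.sub_add_cancel hn, hL.pipeExit_east_last h]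
    · rw [show i + 1 = n by omega, hL.pipeExit_south_last (by omega)]
      omega
  have hmem : ∀ z, n ≤ z → z < 2 * n → (g z, 2 * n - 1 - z) ∈ L.pluses := fun z h1 h2 =>
    (hLg _ _).mpr ⟨hg.lt z h1 h2, by omega, Or.inl (by congr 1; omega)⟩
  have hbelow : ∀ z, n ≤ z → z < 2 * n →
      L.pipeExit (g z) (2 * n - 1 - z) .east = z := fun z h1 h2 => by
    have := hg.lt z h1 h2
    rw [pipeExit_east_of_mem (hmem z h1 h2),
      hL.pipeExit_south_straight (i' := n) (by omega) le_rfl (by omega),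
      hL.pipeExit_south_last (by omega)]
    · omega
    · intro k hk hk' hp
      rw [hLg, show 2 * n - 1 - (2 * n - 1 - z) = z by omega] at hp
      rcases hp.2.2 with h | h
      · omega
      · rw [show z = n by omega] at hk
        omega
  have habove : ∀ z, n < z → z < 2 * n →
      L.pipeExit 0 (2 * n - 1 - z) .south = L.pipeExit (g z) (2 * n - 1 - (z - 1)) .east := by
    intro z h1 h2
    have := hg.lt z h1.le h2
    rw [hL.pipeExit_south_straight (i' := g z) (Nat.zero_le _) (by omega) (by omega),
      pipeExit_south_of_mem (hmem z h1.le h2)]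
    · congr 1
      omega
    · intro k _ hk' hp
      rw [hLg, show 2 * n - 1 - (2 * n - 1 - z) = z by omega] at hp
      omega
  rcases h with h | h | h | h | h
  · refine ⟨by omega, fun _ _ => ?_⟩
    rw [h.1, h.2, show 2 * n - 1 - n = n - 1 by omega,
      pipeExit_south_of_mem ((hLg _ _).mpr ⟨hn, by omega, Or.inr (by omega)⟩),
      Nat.sub_add_cancel hn, hL.pipeExit_east_last hn]
  · refine ⟨fun hx => ?_, by omega⟩
    rw [hL.pipeExit_east_straight (j' := n - 1) (Nat.zero_le _) (by omega) hx, hlast x hx, h.2.2]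
    intro k _ hk hp
    rw [hLg] at hp
    exact h.2.1 (2 * n - 1 - k) (by omega) (by omega) (by omega)
  · obtain ⟨_, h1, h2, h3, h4⟩ := h
    refine ⟨fun hx => ?_, by omega⟩
    -- By antitonicity the leftmost plus of row `x` is in the column of the largest label `y` with
    -- `g y = x`.
    have := hbelow y h1 h2
    rw [h3] at this
    rw [hL.pipeExit_east_straight (j' := 2 * n - 1 - y) (Nat.zero_le _) (by omega) hx, this]
    intro k _ hk hp
    rw [hLg] at hp
    have h5 := hg.anti y (y + 1) h1 (by omega) (by omega)
    have h6 := hg.anti (y + 1) (2 * n - 1 - k) (by omega) (by omega) (by omega)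
    have := h4 (by omega)
    omega
  · refine ⟨by omega, fun _ _ => ?_⟩
    rw [habove x h.1 h.2.1, h.2.2.1, hbelow (x - 1) (by omega) (by omega), h.2.2.2]
  · refine ⟨by omega, fun _ _ => ?_⟩
    have hlt := hg.lt x h.1.le h.2.1
    rw [habove x h.1 h.2.1, hL.pipeExit_east_straight (j' := n - 1) (by omega) (by omega) hlt,
      hlast _ hlt, h.2.2.2]
    intro k hk hk' hp
    rw [hLg] at hp
    have h5 := hg.anti (x - 1) x (by omega) (by omega) (by omega)
    have h6 := hg.anti (2 * n - 1 - k) (x - 1) (by omega) (by omega) (by omega)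
    omega

theorem exists_hasStaircase (hg : IsStaircase n g) :
    ∃ L : LeDiagram n (2 * n), L.IsSquare ∧ L.HasStaircase g := by
  refine ⟨⟨by omega, ⟨Finset.range n ×ˢ Finset.range n, ?_⟩, ?_,
    (Finset.range n ×ˢ Finset.range n).filter
      fun c => c.1 = g (2 * n - 1 - c.2) ∨ c.2 + 1 = n, Finset.filter_subset _ _, ?_⟩, ?_, ?_⟩
  · rintro ⟨i, j⟩ ⟨i', j'⟩ ⟨h1, h2⟩ h
    simp only [Finset.coe_product, Finset.coe_range, Set.mem_prod, Set.mem_Iio] at h h1 h2 ⊢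
    omega
  · rintro ⟨i, j⟩ h
    simp only [Finset.mem_product, Finset.mem_range] at h ⊢
    omega
  · intro i j i' j' h hi hp hj hp'
    simp only [Finset.mem_filter, Finset.mem_product, Finset.mem_range] at h hp hp' ⊢
    -- Bottom pluses move weakly down to the right, so the forbidden pattern could only end in the
    -- last column, which is full.
    have := hg.anti (2 * n - 1 - j) (2 * n - 1 - j') (by omega) (by omega) (by omega)
    omega
  · intro i j
    simp
  · intro i j
    simp [and_assoc]

end Staircase

/-! ### A square Le-diagram is determined by its pipes. -/

section Uniqueness

/-- Where a pipe moving east goes that is about to enter the box `(i, j)` of a filling `p`: it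
turns south in the next column with a plus, or leaves row `i`. Columns are recorded by `Sum.inr`
and rows by `Sum.inl`. -/
noncomputable def eastState (p : ℕ → ℕ → Prop) (i j : ℕ) : ℕ ⊕ ℕ :=
  open Classical in
  if h : ∃ k, j ≤ k ∧ p i k then Sum.inr (Nat.find h) else Sum.inl i

open Classical in
/-- The effect of row `i` of a filling on the pipes: the pipe in `Sum.inl x` with `x ≥ i` has not
entered the diagram yet, the one in `Sum.inl x` with `x < i` has left it. -/
noncomputable def rowStep (p : ℕ → ℕ → Prop) (i : ℕ) : ℕ ⊕ ℕ → ℕ ⊕ ℕ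
  | Sum.inl x => if x = i then eastState p i 0 else Sum.inl x
  | Sum.inr j => if p i j then eastState p i (j + 1) else Sum.inr j

/-- The effect of the rows above row `r` on the pipes. -/
noncomputable def rowSteps (p : ℕ → ℕ → Prop) : ℕ → ℕ ⊕ ℕ → ℕ ⊕ ℕ
  | 0, s => s
  | r + 1, s => rowStep p r (rowSteps p r s)

variable {p : ℕ → ℕ → Prop}

theorem eastState_spec (p : ℕ → ℕ → Prop) (i j : ℕ) :
    (∃ k, eastState p i j = Sum.inr k ∧ j ≤ k ∧ p i k ∧ ∀ l, j ≤ l → l < k → ¬ p i l) ∨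
      (eastState p i j = Sum.inl i ∧ ∀ l, j ≤ l → ¬ p i l) := by
  classical
  by_cases h : ∃ k, j ≤ k ∧ p i k
  · left
    refine ⟨Nat.find h, dif_pos h, (Nat.find_spec h).1, (Nat.find_spec h).2,
      fun l h1 h2 h3 => Nat.find_min h h2 ⟨h1, h3⟩⟩
  · right
    exact ⟨dif_neg h, fun l h1 h2 => h ⟨l, h1, h2⟩⟩

theorem eastState_eq_eastState {i j k : ℕ} (h : eastState p i j = eastState p i k)
    (l : ℕ) (hl : j ≤ l) (hl' : l < k) : ¬ p i l := by
  rcases eastState_spec p i j with ⟨a, h1, h2, h3, h4⟩ | ⟨h1, h2⟩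
  · rcases eastState_spec p i k with ⟨b, h1', h2', h3', h4'⟩ | ⟨h1', h2'⟩
    · rw [h1, h1', Sum.inr.injEq] at h
      exact h4 l hl (by omega)
    · rw [h1, h1'] at h
      exact absurd h (by simp)
  · exact h2 l hl

/-- Pipes never merge: two pipes leaving in the same state would have no plus between them, yet one
of them must have turned at such a plus. This lets the last row be cancelled in the uniqueness
proof. -/
theorem rowStep_injective (p : ℕ → ℕ → Prop) (i : ℕ) : Function.Injective (rowStep p i) := by
  have key : ∀ j x, rowStep p i (Sum.inl x) ≠ rowStep p i (Sum.inr j) := by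
    intro j x h
    unfold rowStep at h
    simp only at h
    split_ifs at h with h1 h2 h2
    · exact eastState_eq_eastState h j (Nat.zero_le _) (Nat.lt_succ_self j) h2
    · rcases eastState_spec p i 0 with ⟨a, h1, _, h3, _⟩ | ⟨h1, _⟩
      · rw [h1, Sum.inr.injEq] at h
        exact h2 (h ▸ h3)
      · rw [h1] at h
        exact absurd h (by simp)
    · rcases eastState_spec p i (j + 1) with ⟨a, h3, _⟩ | ⟨h3, _⟩
      · rw [h3] at h
        exact absurd h (by simp)
      · rw [h3, Sum.inl.injEq] at h
        exact h1 h
  have key' : ∀ j k, j < k → rowStep p i (Sum.inr j) ≠ rowStep p i (Sum.inr k) := by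
    intro j k hjk h
    unfold rowStep at h
    simp only at h
    split_ifs at h with h1 h2 h2
    · exact eastState_eq_eastState h k (by omega) (by omega) h2
    · rcases eastState_spec p i (j + 1) with ⟨a, h3, _, h5, _⟩ | ⟨h3, _⟩
      · rw [h3, Sum.inr.injEq] at h
        exact h2 (h ▸ h5)
      · rw [h3] at h
        exact absurd h (by simp)
    · rcases eastState_spec p i (k + 1) with ⟨a, h3, h4, _⟩ | ⟨h3, _⟩
      · rw [h3, Sum.inr.injEq] at h
        omega
      · rw [h3] at h
        exact absurd h (by simp)
    · rw [Sum.inr.injEq] at h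
      omega
  rintro (x | j) (y | k) h
  · unfold rowStep at h
    simp only at h
    split_ifs at h with h1 h2 h2
    · rw [h1, h2]
    · rcases eastState_spec p i 0 with ⟨a, h3, _⟩ | ⟨h3, _⟩
      · rw [h3] at h
        exact absurd h (by simp)
      · rw [h3, Sum.inl.injEq] at h
        exact absurd h.symm h2
    · rcases eastState_spec p i 0 with ⟨a, h3, _⟩ | ⟨h3, _⟩
      · rw [h3] at h
        exact absurd h (by simp)
      · rw [h3, Sum.inl.injEq] at h
        exact absurd h h1
    · exact h
  · exact absurd h (key k x)
  · exact absurd h.symm (key j y)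
  · rcases lt_trichotomy j k with hjk | rfl | hjk
    · exact absurd h (key' j k hjk)
    · rfl
    · exact absurd h.symm (key' k j hjk)

theorem rowSteps_inl_of_le (p : ℕ → ℕ → Prop) {r x : ℕ} (h : r ≤ x) :
    rowSteps p r (Sum.inl x) = Sum.inl x := by
  induction r with
  | zero => rfl
  | succ r ih =>
    rw [rowSteps, ih (by omega), rowStep, if_neg (by omega)]

/-- A pipe entering from the north stays in its column iff the column has no plus. -/
theorem rowSteps_inr_eq_iff (p : ℕ → ℕ → Prop) (r j : ℕ) :
    rowSteps p r (Sum.inr j) = Sum.inr j ↔ ∀ i < r, ¬ p i j := by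
  -- After its first plus a pipe is in a column further right or has left through a row, and it
  -- never comes back.
  have key : (rowSteps p r (Sum.inr j) = Sum.inr j ∧ ∀ i < r, ¬ p i j) ∨
      (((∃ k, j < k ∧ rowSteps p r (Sum.inr j) = Sum.inr k) ∨
        ∃ x < r, rowSteps p r (Sum.inr j) = Sum.inl x) ∧ ∃ i < r, p i j) := by
    induction r with
    | zero => exact Or.inl ⟨rfl, by simp⟩
    | succ r ih =>
      rw [rowSteps]
      rcases ih with ⟨h1, h2⟩ | ⟨h1 | h1, h2⟩
      · rw [h1, rowStep]
        by_cases h : p r j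
        · rw [if_pos h]
          refine Or.inr ⟨?_, r, by omega, h⟩
          rcases eastState_spec p r (j + 1) with ⟨a, h3, h4, _⟩ | ⟨h3, _⟩
          · exact Or.inl ⟨a, h4, h3⟩
          · exact Or.inr ⟨r, by omega, h3⟩
        · rw [if_neg h]
          refine Or.inl ⟨rfl, fun i hi => ?_⟩
          rcases Nat.lt_succ_iff_lt_or_eq.mp hi with hi | rfl
          · exact h2 i hi
          · exact h
      · obtain ⟨k, hk, h1⟩ := h1
        obtain ⟨i, hi, h2⟩ := h2
        refine Or.inr ⟨?_, i, by omega, h2⟩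
        rw [h1, rowStep]
        by_cases h : p r k
        · rw [if_pos h]
          rcases eastState_spec p r (k + 1) with ⟨a, h3, h4, _⟩ | ⟨h3, _⟩
          · exact Or.inl ⟨a, by omega, h3⟩
          · exact Or.inr ⟨r, by omega, h3⟩
        · rw [if_neg h]
          exact Or.inl ⟨k, hk, rfl⟩
      · obtain ⟨x, hx, h1⟩ := h1
        obtain ⟨i, hi, h2⟩ := h2
        refine Or.inr ⟨Or.inr ⟨x, by omega, ?_⟩, i, by omega, h2⟩
        rw [h1, rowStep, if_neg (by omega)]
  rcases key with ⟨h1, h2⟩ | ⟨⟨k, hk, h1⟩ | ⟨x, hx, h1⟩, i, hi, h2⟩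
  · exact iff_of_true h1 h2
  · refine iff_of_false ?_ fun h => h i hi h2
    rw [h1, Sum.inr.injEq]
    omega
  · refine iff_of_false ?_ fun h => h i hi h2
    rw [h1]
    simp

/-- A filling that satisfies the Le-condition is determined by its pipes. -/
theorem filling_eq_of_rowSteps_eq {p p' : ℕ → ℕ → Prop}
    (hp : ∀ i j i' j', i' < i → p i' j → j' < j → p i j' → p i j)
    (hp' : ∀ i j i' j', i' < i → p' i' j → j' < j → p' i j' → p' i j)
    {r : ℕ} (h : ∀ s, rowSteps p r s = rowSteps p' r s) : ∀ i < r, p i = p' i := by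
  induction r with
  | zero => simp
  | succ r ih =>
    have hcol : ∀ j, (∃ i < r + 1, p i j) ↔ ∃ i < r + 1, p' i j := fun j => by
      have h1 := rowSteps_inr_eq_iff p (r + 1) j
      rw [h, rowSteps_inr_eq_iff] at h1
      have h2 := not_congr h1
      push Not at h2
      exact h2.symm
    have hfirst : eastState p r 0 = eastState p' r 0 := by
      have h1 := h (Sum.inl r)
      rwa [rowSteps, rowSteps, rowSteps_inl_of_le p le_rfl, rowSteps_inl_of_le p' le_rfl, rowStep,
        rowStep, if_pos rfl, if_pos rfl] at h1
    -- From a plus of the last row onwards, the Le-condition puts a plus in exactly those columns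
    -- that contain one. So the last row is determined by its first plus and the set of nonempty
    -- columns, both visible from the pipes.
    have hrow : ∀ {q : ℕ → ℕ → Prop} (hq : ∀ i j i' j', i' < i → q i' j → j' < j → q i j' → q i j)
        {k : ℕ}, q r k → ∀ j, k ≤ j → (q r j ↔ ∃ i < r + 1, q i j) := by
      intro q hq k hk j hj
      refine ⟨fun h => ⟨r, by omega, h⟩, ?_⟩
      rintro ⟨i, hi, hij⟩
      rcases Nat.lt_succ_iff_lt_or_eq.mp hi with hi | rfl
      · rcases hj.eq_or_lt with rfl | hj
        · exact hk
        · exact hq r j i k hi hij hj hk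
      · exact hij
    have hr : p r = p' r := by
      ext j
      rcases eastState_spec p r 0 with ⟨a, h1, _, h3, h4⟩ | ⟨h1, h2⟩ <;>
        rcases eastState_spec p' r 0 with ⟨b, h1', _, h3', h4'⟩ | ⟨h1', h2'⟩ <;>
        rw [h1, h1'] at hfirst
      · rw [Sum.inr.injEq] at hfirst
        subst hfirst
        rcases Nat.lt_or_ge j a with hj | hj
        · exact iff_of_false (h4 j (Nat.zero_le _) hj) (h4' j (Nat.zero_le _) hj)
        · rw [hrow hp h3 j hj, hrow hp' h3' j hj, hcol]
      · exact absurd hfirst (by simp)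
      · exact absurd hfirst (by simp)
      · exact iff_of_false (h2 j (Nat.zero_le _)) (h2' j (Nat.zero_le _))
    have hstep : rowStep p r = rowStep p' r := by
      have heast : ∀ j, eastState p r j = eastState p' r j := fun j => by
        change eastState (fun _ => p r) r j = eastState (fun _ => p' r) r j
        rw [hr]
      ext (x | j) : 1
      · rw [rowStep, rowStep, heast]
      · have hj : p r j ↔ p' r j := by rw [hr]
        rw [rowStep, rowStep, heast]
        by_cases h : p' r j <;> simp [hj, h]
    intro i hi
    rcases Nat.lt_succ_iff_lt_or_eq.mp hi with hi | rfl
    · refine ih (fun s => rowStep_injective p r ?_) i hi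
      have := h s
      rw [rowSteps, rowSteps, ← hstep] at this
      exact this
    · exact hr

variable {n : ℕ} {L : LeDiagram n (2 * n)}

/-- Where the pipe in a given state leaves the diagram, when it is about to enter row `k`. -/
def exitFrom (L : LeDiagram n (2 * n)) (k : ℕ) : ℕ ⊕ ℕ → ℕ
  | Sum.inl x => if x < k then x else L.pipeExit x 0 .east
  | Sum.inr j => L.pipeExit k j .south

/-- The rows and columns of the square. -/
def InSquare (n : ℕ) : ℕ ⊕ ℕ → Prop := Sum.elim (· < n) (· < n)

theorem IsSquare.pipeExit_east_eq (hL : L.IsSquare) {i j : ℕ} (hi : i < n) (hj : j ≤ n) :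
    L.pipeExit i j .east = L.exitFrom (i + 1) (eastState (fun i j => (i, j) ∈ L.pluses) i j) ∧
      InSquare n (eastState (fun i j => (i, j) ∈ L.pluses) i j) := by
  rcases eastState_spec (fun i j => (i, j) ∈ L.pluses) i j with ⟨k, h1, h2, h3, h4⟩ | ⟨h1, h2⟩
  · have := hL.lt_of_mem h3
    rw [h1, hL.pipeExit_east_straight h2 (by omega) hi h4, pipeExit_east_of_mem h3]
    exact ⟨rfl, this.2⟩
  · rw [h1, hL.pipeExit_east_straight hj le_rfl hi fun l h _ => h2 l h, hL.pipeExit_east_last hi,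
      exitFrom, if_pos (by omega)]
    exact ⟨rfl, hi⟩

theorem IsSquare.exitFrom_rowStep (hL : L.IsSquare) {k : ℕ} (hk : k < n) {s : ℕ ⊕ ℕ}
    (hs : InSquare n s) :
    L.exitFrom k s = L.exitFrom (k + 1) (rowStep (fun i j => (i, j) ∈ L.pluses) k s) ∧
      InSquare n (rowStep (fun i j => (i, j) ∈ L.pluses) k s) := by
  rcases s with x | j
  · rw [rowStep]
    by_cases h : x = k
    · subst h
      rw [if_pos rfl, exitFrom, if_neg (lt_irrefl _)]
      exact hL.pipeExit_east_eq hk (Nat.zero_le _)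
    · rw [if_neg h, exitFrom, exitFrom]
      refine ⟨?_, hs⟩
      congr 1
      exact propext (by omega)
  · rw [rowStep, exitFrom]
    have hj : j < n := hs
    by_cases h : (k, j) ∈ L.pluses
    · rw [if_pos h, pipeExit_south_of_mem h]
      exact hL.pipeExit_east_eq hk hj
    · rw [if_neg h, pipeExit_south_of_notMem ((hL _ _).mpr ⟨hk, hj⟩) h]
      exact ⟨rfl, hs⟩

theorem IsSquare.exitFrom_rowSteps (hL : L.IsSquare) {k : ℕ} (hk : k ≤ n) {s : ℕ ⊕ ℕ}
    (hs : InSquare n s) :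
    L.exitFrom 0 s = L.exitFrom k (rowSteps (fun i j => (i, j) ∈ L.pluses) k s) ∧
      InSquare n (rowSteps (fun i j => (i, j) ∈ L.pluses) k s) := by
  induction k with
  | zero => exact ⟨rfl, hs⟩
  | succ k ih =>
    obtain ⟨h1, h2⟩ := ih (by omega)
    obtain ⟨h3, h4⟩ := hL.exitFrom_rowStep hk h2
    exact ⟨h1.trans h3, h4⟩

/-- Exits through rows have labels below `n`, exits through columns labels at least `n`, so the exit
label determines the final state. -/
theorem IsSquare.eq_of_exitFrom_eq (hL : L.IsSquare) {L' : LeDiagram n (2 * n)}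
    (hL' : L'.IsSquare) {s s' : ℕ ⊕ ℕ} (hs : InSquare n s) (hs' : InSquare n s')
    (h : L.exitFrom n s = L'.exitFrom n s') : s = s' := by
  rcases s with x | j <;> rcases s' with y | k <;> simp only [InSquare, Sum.elim_inl,
    Sum.elim_inr] at hs hs' <;> simp only [exitFrom, hs, hs', if_true, hL.pipeExit_south_last,
      hL'.pipeExit_south_last] at h
  · rw [h]
  · omega
  · omega
  · rw [Sum.inr.injEq]
    omega

theorem rowStep_of_not_inSquare (hL : L.IsSquare) {k : ℕ} (hk : k < n) {s : ℕ ⊕ ℕ}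
    (hs : ¬ InSquare n s) : rowStep (fun i j => (i, j) ∈ L.pluses) k s = s := by
  rcases s with x | j
  · rw [rowStep, if_neg]
    rintro rfl
    exact hs hk
  · rw [rowStep, if_neg fun h => hs (hL.lt_of_mem h).2]

/-- `filling_eq_of_rowSteps_eq` asks for agreement on all states, including those outside the
square. -/
theorem rowSteps_of_not_inSquare (hL : L.IsSquare) {k : ℕ} (hk : k ≤ n) {s : ℕ ⊕ ℕ}
    (hs : ¬ InSquare n s) : rowSteps (fun i j => (i, j) ∈ L.pluses) k s = s := by
  induction k with
  | zero => rfl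
  | succ k ih => rw [rowSteps, ih (by omega), rowStep_of_not_inSquare hL hk hs]

/-- A square Le-diagram is determined by its pipes. -/
theorem IsSquare.pluses_eq (hL : L.IsSquare) {L' : LeDiagram n (2 * n)} (hL' : L'.IsSquare)
    (hrow : ∀ i < n, L.pipeExit i 0 .east = L'.pipeExit i 0 .east)
    (hcol : ∀ j < n, L.pipeExit 0 j .south = L'.pipeExit 0 j .south) : L.pluses = L'.pluses := by
  have hle : ∀ {L : LeDiagram n (2 * n)} (_ : L.IsSquare) (i j i' j' : ℕ), i' < i → (i', j) ∈ L.pluses →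
      j' < j → (i, j') ∈ L.pluses → (i, j) ∈ L.pluses := fun {L} hL i j i' j' h1 h2 h3 h4 =>
    L.le_condition i j i' j' ((hL _ _).mpr ⟨(hL.lt_of_mem h4).1, (hL.lt_of_mem h2).2⟩) h1 h2 h3 h4
  have key := filling_eq_of_rowSteps_eq (p := fun i j => (i, j) ∈ L.pluses)
    (p' := fun i j => (i, j) ∈ L'.pluses) (r := n) (hle hL) (hle hL') fun s => by
      by_cases hs : InSquare n s
      · obtain ⟨h1, h2⟩ := hL.exitFrom_rowSteps le_rfl hs
        obtain ⟨h1', h2'⟩ := hL'.exitFrom_rowSteps le_rfl hs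
        refine hL.eq_of_exitFrom_eq hL' h2 h2' (h1.symm.trans (Eq.trans ?_ h1'))
        rcases s with x | j
        · exact hrow x hs
        · exact hcol j hs
      · rw [rowSteps_of_not_inSquare hL le_rfl hs, rowSteps_of_not_inSquare hL' le_rfl hs]
  ext ⟨i, j⟩
  by_cases hi : i < n
  · exact iff_of_eq (congrFun (key i hi) j)
  · exact iff_of_false (fun h => hi (hL.lt_of_mem h).1) fun h => hi (hL'.lt_of_mem h).1

end Uniqueness

end LeDiagram

/-! ### Lattice paths and the heights of their east steps. -/

namespace DyckStep

/-- The horizontal steps of a lattice path from the origin, see `DyckWord.eastSteps`. -/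
def eastSteps (w : List DyckStep) : Set (ℕ × ℕ) :=
  {s | ∃ k : ℕ, w[k]? = some D ∧ s = ((w.take k).count U, (w.take k).count D)}

theorem eastSteps_append_U (w : List DyckStep) : eastSteps (w ++ [U]) = eastSteps w := by
  ext s
  refine exists_congr fun k => ?_
  rcases lt_trichotomy k w.length with h | rfl | h
  · rw [List.getElem?_append_left h, List.take_append_of_le_length h.le]
  · simp
  · rw [List.getElem?_eq_none (by simp; omega), List.getElem?_eq_none h.le]
    simp

theorem eastSteps_append_D (w : List DyckStep) :
    eastSteps (w ++ [D]) = insert (w.count U, w.count D) (eastSteps w) := by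
  ext s
  simp only [eastSteps, Set.mem_insert_iff, Set.mem_ofPred_eq]
  constructor
  · rintro ⟨k, hk, rfl⟩
    rcases lt_trichotomy k w.length with h | rfl | h
    · rw [List.getElem?_append_left h] at hk
      rw [List.take_append_of_le_length h.le]
      exact Or.inr ⟨k, hk, rfl⟩
    · left
      simp
    · rw [List.getElem?_eq_none (by simp; omega)] at hk
      exact absurd hk (by simp)
  · rintro (rfl | ⟨k, hk, rfl⟩)
    · exact ⟨w.length, by simp, by simp⟩
    · have h : k < w.length := (List.getElem?_eq_some_iff.mp hk).1
      refine ⟨k, by rw [List.getElem?_append_left h, hk], ?_⟩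
      rw [List.take_append_of_le_length h.le]

theorem length_eq_count_add_count (w : List DyckStep) : w.length = w.count U + w.count D := by
  induction w with
  | nil => rfl
  | cons a w ih =>
    cases a <;> simp [ih] <;> omega

/-- The horizontal steps of a lattice path are given by their heights. -/
theorem exists_heights (w : List DyckStep) :
    ∃ h : ℕ → ℕ, (∀ i j, i ≤ j → j < w.count D → h i ≤ h j) ∧
      (∀ j < w.count D, h j ≤ w.count U) ∧
      eastSteps w = {s | s.2 < w.count D ∧ s.1 = h s.2} := by
  induction w using List.reverseRecOn with
  | nil => exact ⟨fun _ => 0, by simp, by simp, by simp [eastSteps]⟩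
  | append_singleton w a ih =>
    obtain ⟨h, h1, h2, h3⟩ := ih
    cases a with
    | U =>
      have e1 : (w ++ [U]).count D = w.count D := by simp
      have e2 : (w ++ [U]).count U = w.count U + 1 := by simp
      rw [eastSteps_append_U, e1, e2]
      exact ⟨h, h1, fun j hj => (h2 j hj).trans (Nat.le_succ _), h3⟩
    | D =>
      have e1 : (w ++ [D]).count D = w.count D + 1 := by simp
      have e2 : (w ++ [D]).count U = w.count U := by simp
      rw [eastSteps_append_D, e1, e2]
      refine ⟨Function.update h (w.count D) (w.count U), fun i j hij hj => ?_, fun j hj => ?_, ?_⟩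
      · rcases Nat.lt_succ_iff_lt_or_eq.mp hj with hj | rfl
        · rw [Function.update_of_ne hj.ne, Function.update_of_ne (by omega)]
          exact h1 i j hij hj
        · rw [Function.update_self]
          rcases hij.eq_or_lt with rfl | hij
          · rw [Function.update_self]
          · rw [Function.update_of_ne hij.ne]
            exact h2 i hij
      · rcases Nat.lt_succ_iff_lt_or_eq.mp hj with hj | rfl
        · rw [Function.update_of_ne hj.ne]
          exact h2 j hj
        · rw [Function.update_self]
      · ext ⟨a, b⟩
        rw [h3]
        simp only [Set.mem_insert_iff, Set.mem_ofPred_eq, Prod.mk.injEq]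
        by_cases hb : b = w.count D
        · subst hb
          simp
        · rw [Function.update_of_ne hb]
          simp only [hb, and_false, false_or]
          exact and_congr_left fun _ => by omega

/-- The path stays weakly on the side of the diagonal prescribed for Dyck words. -/
def IsBallot (w : List DyckStep) : Prop := ∀ i, (w.take i).count D ≤ (w.take i).count U

theorem IsBallot.append_singleton {w : List DyckStep} (hw : IsBallot w) {a : DyckStep}
    (h : (w ++ [a]).count D ≤ (w ++ [a]).count U) : IsBallot (w ++ [a]) := by
  intro i
  rcases Nat.lt_or_ge w.length i with hi | hi
  · rwa [List.take_of_length_le (by simp; omega)]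
  · rw [List.take_append_of_le_length hi]
    exact hw i

theorem IsBallot.count_le {w : List DyckStep} (hw : IsBallot w) : w.count D ≤ w.count U := by
  have := hw w.length
  rwa [List.take_length] at this

theorem IsBallot.exists_raise {w : List DyckStep} (hw : IsBallot w) (k : ℕ) :
    ∃ w' : List DyckStep, IsBallot w' ∧ w'.count D = w.count D ∧ w'.count U = w.count U + k ∧
      eastSteps w' = eastSteps w := by
  induction k with
  | zero => exact ⟨w, hw, rfl, rfl, rfl⟩
  | succ k ih =>
    obtain ⟨w', h1, h2, h3, h4⟩ := ih
    refine ⟨w' ++ [U], h1.append_singleton ?_, ?_, ?_, by rw [eastSteps_append_U, h4]⟩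
    · have := hw.count_le
      simp [h2, h3]
      omega
    · simp [h2]
    · simp [h3]
      omega

/-- The ballot path with horizontal steps of given heights. -/
theorem exists_isBallot (h : ℕ → ℕ) (m : ℕ) (hmono : ∀ i j, i ≤ j → j < m → h i ≤ h j)
    (hdiag : ∀ j < m, j + 1 ≤ h j) :
    ∃ w : List DyckStep, IsBallot w ∧ w.count D = m ∧
      w.count U = (if m = 0 then 0 else h (m - 1)) ∧
      eastSteps w = {s | s.2 < m ∧ s.1 = h s.2} := by
  induction m with
  | zero => exact ⟨[], by simp [IsBallot], rfl, rfl, by simp [eastSteps]⟩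
  | succ m ih =>
    obtain ⟨w, h1, h2, h3, h4⟩ := ih (fun i j hij hj => hmono i j hij (by omega))
      fun j hj => hdiag j (by omega)
    have hle : w.count U ≤ h m := by
      rw [h3]
      split_ifs
      · exact Nat.zero_le _
      · exact hmono _ _ (by omega) (by omega)
    -- The path is first lowered to depth `h m` by south steps, which add no horizontal step.
    obtain ⟨w', h1', h2', h3', h4'⟩ := h1.exists_raise (h m - w.count U)
    rw [Nat.add_sub_cancel' hle] at h3'
    refine ⟨w' ++ [D], h1'.append_singleton ?_, ?_, ?_, ?_⟩
    · have := hdiag m (by omega)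
      simp [h2', h3', h2]
      omega
    · simp [h2', h2]
    · simp [h3']
    · rw [eastSteps_append_D, h2', h3', h4', h4, h2]
      ext ⟨a, b⟩
      simp only [Set.mem_insert_iff, Set.mem_ofPred_eq, Prod.mk.injEq]
      constructor
      · rintro (⟨rfl, rfl⟩ | ⟨h5, h6⟩)
        · exact ⟨by omega, rfl⟩
        · exact ⟨by omega, h6⟩
      · rintro ⟨h5, h6⟩
        rcases Nat.lt_succ_iff_lt_or_eq.mp h5 with h5 | rfl
        · exact Or.inr ⟨h5, h6⟩
        · exact Or.inl ⟨h6, rfl⟩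

end DyckStep

/-! ### The two conditions of the theorem and staircases. -/

namespace LeDiagram

variable {n : ℕ} {L : LeDiagram n (2 * n)} {g : ℕ → ℕ}

theorem HasStaircase.ncard_col (hLg : L.HasStaircase g) (hg : IsStaircase n g) {j : ℕ}
    (hj : j < n) : {i : ℕ | (i, j) ∈ L.pluses}.ncard = if j + 1 = n then n else 1 := by
  split_ifs with h
  · have : {i : ℕ | (i, j) ∈ L.pluses} = (Finset.range n : Set ℕ) := by
      ext i
      rw [Set.mem_ofPred_eq, hLg, Finset.mem_coe, Finset.mem_range]
      tauto
    rw [this, Set.ncard_coe_finset, Finset.card_range]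
  · rw [Set.ncard_eq_one]
    refine ⟨g (2 * n - 1 - j), ?_⟩
    ext i
    have := hg.lt (2 * n - 1 - j) (by omega) (by omega)
    rw [Set.mem_ofPred_eq, hLg, Set.mem_singleton_iff]
    omega

theorem HasStaircase.bottomSteps_eq (hLg : L.HasStaircase g) (hg : IsStaircase n g) :
    L.bottomSteps = {s | s.2 < n ∧ s.1 = g (2 * n - 1 - s.2) + 1} := by
  ext ⟨a, j⟩
  simp only [bottomSteps, Set.mem_ofPred_eq, Prod.mk.injEq]
  constructor
  · rintro ⟨i, j', h1, h2, rfl, rfl⟩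
    rw [hLg] at h1
    refine ⟨h1.2.1, ?_⟩
    have hlt := hg.lt (2 * n - 1 - j) (by omega) (by omega)
    have hd := hg.diag_le (2 * n - 1 - j) (by omega) (by omega)
    have := h2 (g (2 * n - 1 - j)) ((hLg _ _).mpr ⟨hlt, h1.2.1, Or.inl rfl⟩)
    omega
  · rintro ⟨hj, rfl⟩
    have hlt := hg.lt (2 * n - 1 - j) (by omega) (by omega)
    have hd := hg.diag_le (2 * n - 1 - j) (by omega) (by omega)
    refine ⟨_, j, (hLg _ _).mpr ⟨hlt, hj, Or.inl rfl⟩, fun i' hi' => ?_, rfl, rfl⟩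
    rw [hLg] at hi'
    omega

/-- The combinatorial conditions on a square Le-diagram say that its pluses form a staircase. -/
theorem IsSquare.conditions_iff (hL : L.IsSquare) (hn : 0 < n) :
    ((∀ j : ℕ, j < n → {i : ℕ | (i, j) ∈ L.pluses}.ncard = if j + 1 = n then n else 1) ∧
      ∃ p : DyckWord, p.toList.length = 2 * n ∧ L.bottomSteps = p.eastSteps) ↔
      ∃ g, IsStaircase n g ∧ L.HasStaircase g := by
  constructor
  · rintro ⟨hcol, p, hlen, hp⟩
    obtain ⟨h, h1, h2, h3⟩ := DyckStep.exists_heights p.toList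
    have hUD := p.count_U_eq_count_D
    rw [DyckStep.length_eq_count_add_count] at hlen
    have hD : p.toList.count DyckStep.D = n := by omega
    have hU : p.toList.count DyckStep.U = n := by omega
    rw [hD] at h1 h2 h3
    rw [hU] at h2
    have hmem : ∀ j < n, (h j, j) ∈ DyckStep.eastSteps p.toList := fun j hj => by
      rw [h3]
      exact ⟨hj, rfl⟩
    have hdiag : ∀ j < n, j + 1 ≤ h j := fun j hj => by
      obtain ⟨k, hk, hkj⟩ := hmem j hj
      rw [Prod.mk.injEq] at hkj
      -- The prefix includes the east step itself, whence `j + 1` rather than `j`.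
      have := p.count_D_le_count_U (k + 1)
      rw [List.take_add_one, hk] at this
      simp only [Option.toList_some, List.count_append, ← hkj.1, ← hkj.2] at this
      simpa using this
    have hplus : ∀ j < n, (h j - 1, j) ∈ L.pluses := fun j hj => by
      have : (h j, j) ∈ L.bottomSteps := hp ▸ hmem j hj
      obtain ⟨i, j', h4, -, h5⟩ := this
      rw [Prod.mk.injEq] at h5
      rw [h5.1, h5.2]
      exact h4
    -- A step of depth `h j` lies below a plus in row `h j - 1`.
    refine ⟨fun x => h (2 * n - 1 - x) - 1, ⟨fun x h4 h5 => ?_, fun x h4 h5 => ?_,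
      fun x y h4 h5 h6 => ?_⟩, fun i j => ?_⟩
    · have := h2 (2 * n - 1 - x) (by omega)
      omega
    · have := hdiag (2 * n - 1 - x) (by omega)
      omega
    · have := h1 (2 * n - 1 - y) (2 * n - 1 - x) (by omega) (by omega)
      omega
    · by_cases hij : i < n ∧ j < n
      · obtain ⟨hi, hj⟩ := hij
        simp only [hi, hj, true_and]
        rw [show 2 * n - 1 - (2 * n - 1 - j) = j by omega]
        have hc := hcol j hj
        split_ifs at hc with hjn
        · refine iff_of_true ?_ (Or.inr hjn)
          have hsub : {i : ℕ | (i, j) ∈ L.pluses} ⊆ (Finset.range n : Set ℕ) := fun k hk => by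
            rw [Finset.mem_coe, Finset.mem_range]
            exact (hL.lt_of_mem hk).1
          have := Set.eq_of_subset_of_ncard_le hsub
            (by rw [hc, Set.ncard_coe_finset, Finset.card_range]) (Finset.finite_toSet _)
          have hi' : i ∈ (Finset.range n : Set ℕ) := by
            rwa [Finset.mem_coe, Finset.mem_range]
          rw [← this] at hi'
          exact hi'
        · obtain ⟨a, ha⟩ := Set.ncard_eq_one.mp hc
          have hm : ∀ k, (k, j) ∈ L.pluses ↔ k = a := fun k => by
            rw [← Set.mem_singleton_iff, ← ha, Set.mem_ofPred_eq]
          have := (hm _).mp (hplus j hj)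
          rw [hm, this]
          simp [hjn]
      · refine iff_of_false (fun h => hij (hL.lt_of_mem h)) fun h => hij ⟨h.1, h.2.1⟩
  · rintro ⟨g, hg, hLg⟩
    refine ⟨fun j hj => hLg.ncard_col hg hj, ?_⟩
    obtain ⟨w, h1, h2, h3, h4⟩ := DyckStep.exists_isBallot (fun j => g (2 * n - 1 - j) + 1) n
      (fun i j hij hj => by
        have := hg.anti (2 * n - 1 - j) (2 * n - 1 - i) (by omega) (by omega) (by omega)
        omega)
      (fun j hj => by
        have := hg.diag_le (2 * n - 1 - j) (by omega) (by omega)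
        omega)
    -- The last east step has depth `g n + 1 = n`, so the path already ends at the corner and is
    -- balanced.
    rw [if_neg hn.ne', show 2 * n - 1 - (n - 1) = n by omega, hg.apply_self hn] at h3
    refine ⟨⟨w, by omega, h1⟩, ?_, ?_⟩
    · change w.length = 2 * n
      rw [DyckStep.length_eq_count_add_count]
      omega
    · rw [hLg.bottomSteps_eq hg]
      exact h4.symm

/-- A pipe in the last row leaves at the end of the row or, having turned south, immediately below a
column of that row, whose label comes later on the border. -/
theorem rowLabel_le_pipeExit (L : LeDiagram n (2 * n)) (hn : 0 < n) (j : ℕ) :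
    L.rowLabel (n - 1) ≤ L.pipeExit (n - 1) j .east := by
  by_cases hc : (n - 1, j) ∈ L.shape.cells
  · have hj := (L.shape_subset _ hc).2
    by_cases hp : (n - 1, j) ∈ L.pluses
    · have h1 : j < L.shape.rowLen (n - 1) := YoungDiagram.mem_iff_lt_rowLen.mp hc
      have h2 : n - 1 < L.shape.colLen j := YoungDiagram.mem_iff_lt_colLen.mp hc
      rw [pipeExit_east_of_mem hp, pipeExit, dif_neg fun h => by
        have := (L.shape_subset _ h).1
        simp only at this
        omega]
      simp only [rowLabel, colLabel] at hj ⊢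
      omega
    · rw [pipeExit_east_of_notMem hc hp]
      exact rowLabel_le_pipeExit L hn (j + 1)
  · rw [pipeExit, dif_neg hc]
termination_by n - j
decreasing_by
  simp only at hj
  omega

end LeDiagram

theorem IsStaircase.exists_positroid {n : ℕ} {g : ℕ → ℕ} (hg : IsStaircase n g) :
    ∃ M : Matroid (Fin (2 * n)), IsUnitIntervalPositroid n M ∧
      ∀ B : Set (Fin (2 * n)), M.IsBase B ↔ LinearIndepOn ℝ (staircaseMatrix n g).col B ∧
        Submodule.span ℝ ((staircaseMatrix n g).col '' B) = ⊤ := by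
  obtain ⟨M, hE, hM⟩ := exists_matroid_of_span_eq_top (span_staircaseMatrix n g)
  obtain ⟨P, _, l, hP, hl, hψ⟩ := hg.exists_unitIntervalOrder
  exact ⟨M, ⟨P, _, l, hP, hl, hψ ▸ ⟨staircaseMatrix_mem_matNonneg hg, hE, hM⟩⟩, hM⟩

/-! ### Matching pipe dreams with staircase permutations. -/

namespace LeDiagram

variable {n : ℕ} {L : LeDiagram n (2 * n)}

/-- If the pipe dream of a Le-diagram is the permutation of a staircase, then the Le-diagram is
the one of the staircase. -/
theorem hasStaircase_of_isPipeDreamOf {g : ℕ → ℕ} (hg : IsStaircase n g) (hn : 0 < n)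
    {π : DecoratedPerm (2 * n)}
    (hπ : ∀ x : Fin (2 * n), StaircaseRel n g x.val (π.perm x).val) (hL : L.IsPipeDreamOf π) :
    L.IsSquare ∧ L.HasStaircase g := by
  have hsq : L.IsSquare := by
    have hlt : L.rowLabel (n - 1) < 2 * n := by
      rw [rowLabel]
      omega
    have h1 := hL.1 ⟨_, hlt⟩ (n - 1) (by omega) rfl
    have h2 := L.rowLabel_le_pipeExit hn 0
    have h3 := hg.rel_lt_iff hn (hπ ⟨_, hlt⟩)
    have h4 := hg.rel_ne hn (hπ ⟨_, hlt⟩)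
    simp only [h1] at h3 h4
    -- The pipe of the last row does not move backward and is not fixed, and only labels below `n`
    -- move forward. Hence the last row has full length `n`, which forces the square.
    have h5 : L.rowLabel (n - 1) < n := by omega
    rw [rowLabel] at h5
    intro i j
    refine ⟨fun h => ?_, fun h => ?_⟩
    · have := L.shape_subset _ h
      simp only at this
      omega
    · rw [YoungDiagram.mem_cells]
      exact L.shape.up_left_mem (show i ≤ n - 1 by omega) le_rfl
        (YoungDiagram.mem_iff_lt_rowLen.mpr (by omega))
  refine ⟨hsq, ?_⟩
  obtain ⟨L', hL', hLg'⟩ := exists_hasStaircase hg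
  -- Both diagrams have pipes given by `π`.
  have : L.pluses = L'.pluses := by
    refine hsq.pluses_eq hL' (fun i hi => ?_) fun j hj => ?_
    · rw [← hL.1 ⟨i, by omega⟩ i hi (hsq.rowLabel_eq hi).symm]
      exact ((hLg'.pipeExit_eq hL' hg hn (hπ ⟨i, by omega⟩)).1 hi).symm
    · rw [← hL.2.1 ⟨2 * n - 1 - j, by omega⟩ j (by omega) (hsq.colLabel_eq hj).symm]
      have := (hLg'.pipeExit_eq hL' hg hn (hπ ⟨2 * n - 1 - j, by omega⟩)).2 (by simp only; omega)
        (by simp only; omega)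
      simp only at this
      rw [show 2 * n - 1 - (2 * n - 1 - j) = j by omega] at this
      exact this.symm
  intro i j
  rw [this]
  exact hLg' i j

theorem HasStaircase.isPipeDreamOf {g : ℕ → ℕ} (hLg : L.HasStaircase g) (hL : L.IsSquare)
    (hg : IsStaircase n g) {π : DecoratedPerm (2 * n)} (hccw : π.ccw = ∅)
    (hπ : ∀ x : Fin (2 * n), StaircaseRel n g x.val (π.perm x).val) : L.IsPipeDreamOf π := by
  refine ⟨fun a i hi ha => ?_, fun a j hj ha => ?_, fun a => ?_⟩
  · rw [hL.rowLabel_eq hi] at ha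
    have := (hLg.pipeExit_eq hL hg (by omega) (hπ a)).1 (by omega)
    rw [← this, ha]
  · rw [hL.colLabel_eq (by omega)] at ha
    have := (hLg.pipeExit_eq hL hg (by omega) (hπ a)).2 (by omega) a.isLt
    rw [← this, ha, show 2 * n - 1 - (2 * n - 1 - j) = j by omega]
  · rw [hccw]
    refine iff_of_false (Finset.notMem_empty a) fun h => ?_
    exact hg.rel_ne (by have := a.isLt; omega) (hπ a) (congrArg Fin.val h.1)

end LeDiagram

theorem mainTheorem4 (n : ℕ) (L : LeDiagram n (2 * n)) :
    (∃ M : Matroid (Fin (2 * n)), IsUnitIntervalPositroid n M ∧ L.Parametrizes M) ↔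
      (∀ i j : ℕ, (i, j) ∈ L.shape.cells ↔ i < n ∧ j < n) ∧
      (∀ j : ℕ, j < n →
        {i : ℕ | (i, j) ∈ L.pluses}.ncard = if j + 1 = n then n else 1) ∧
      (∃ p : DyckWord, p.toList.length = 2 * n ∧ L.bottomSteps = p.eastSteps) := by
  -- For `n = 0` both sides hold, with empty data; the staircase lemmas use label `n`, which
  -- requires `0 < n`.
  rcases Nat.eq_zero_or_pos n with rfl | hn
  · have hcells : ∀ c, c ∉ L.shape.cells := fun c hc => by
      have := L.shape_subset c hc
      omega
    refine iff_of_true ?_ ⟨fun i j => iff_of_false (hcells _) (by omega), by simp, 0, rfl, ?_⟩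
    · have hg : IsStaircase 0 id := ⟨by omega, by omega, by omega⟩
      obtain ⟨M, hM, -⟩ := hg.exists_positroid
      exact ⟨M, hM, fun i => i.elim0, ⟨1, ∅, by simp⟩, fun i => i.elim0, fun i => i.elim0,
        fun a => a.elim0, fun a => a.elim0, fun a => a.elim0⟩
    · ext s
      refine iff_of_false ?_ ?_
      · rintro ⟨i, j, h, -⟩
        exact hcells _ (L.pluses_subset h)
      · rintro ⟨k, hk, -⟩
        exact absurd (show ([] : List DyckStep)[k]? = some DyckStep.D from hk) (by simp)
  constructor
  · rintro ⟨M, ⟨P, _, l, hP, hl, hM⟩, I, σ, hI, hσ, hL⟩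
    obtain ⟨g, hg, hψ⟩ := exists_staircaseMatrix_eq l hP hl
    rw [hψ] at hM
    obtain ⟨π, hπ⟩ := hg.exists_perm hn
    obtain rfl := isNecklaceOf_unique hI (hg.isNecklaceOf hπ hM.2.2)
    rw [isDecoratedPermOf_necklaceOfPerm
      fun x h => hg.rel_ne hn (hπ x) (congrArg Fin.val h)] at hσ
    subst hσ
    obtain ⟨hsq, hLg⟩ := LeDiagram.hasStaircase_of_isPipeDreamOf hg hn hπ hL
    exact ⟨hsq, (hsq.conditions_iff hn).mpr ⟨g, hg, hLg⟩⟩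
  · rintro ⟨hsq, h⟩
    have hsq : L.IsSquare := hsq
    obtain ⟨g, hg, hLg⟩ := (hsq.conditions_iff hn).mp h
    obtain ⟨M, hM, hbase⟩ := hg.exists_positroid
    obtain ⟨π, hπ⟩ := hg.exists_perm hn
    exact ⟨M, hM, necklaceOfPerm π, ⟨π, ∅, by simp⟩, hg.isNecklaceOf hπ hbase,
      (isDecoratedPermOf_necklaceOfPerm
        (fun x h => hg.rel_ne hn (hπ x) (congrArg Fin.val h)) _).mpr rfl,
      hLg.isPipeDreamOf hsq hg rfl hπ⟩
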